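/- **Theorem 3 (TEE Resistance to Trust Inversion).** All algorithms are given for each security parameter $\lambda$; "efficient" means non-uniform probabilistic polynomial time, and $\mathrm{negl}$ is a function with $\lambda^k\,\mathrm{negl}(\lambda)\to 0$ for every $k$. *Protocol $\Pi_{\mathrm{TEE}}$.* Its ingredients are an efficient signature scheme $(\mathsf{KeyGen},\mathsf{Sign},\mathsf{Vf})$, an efficient attestation scheme for hardware quotes, a hash $H$, a MAC, a sequential work function $\mathsf{SWF}$ (output, proof and check), a behavioural feature map with an acceptance policy, an enclave measurement, a polynomial size for fixed-size fields, and an input channel of one of three tiers. $H$, the MAC, the outputs and proofs of $\mathsf{SWF}$, and the features are efficient, with values of polynomially bounded length. A software channel passes all events, an OS-mediated one only events posted at the operating system's input hooks or coming from the physical device, and a hardware-bound one only genuine human events on the physical device. The enclave holds $sk$; a quote binds $pk$ to its measurement; the hash chain and the work chain start from the verifier's uniformly random $\lambda$-bit nonce. A checkpoint consists of its position, the hash of its predecessor, the digest of the content and the features and number of the events received since the last checkpoint, the output $y$ and proof of $\mathsf{SWF}$ on (previous work output, previous hash, digest, features), and a MAC under key $y$ of digest, features and work proof. It is signed with $sk$.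 After a crash the enclave resumes from the latest sealed state, loses the events received since the last checkpoint, and issues a signed recovery marker that records the gap. $\mathsf{Verify}(pk,E)=1$ holds if $E$ consists of a valid quote for $pk$ and a chain, beginning at position 1, of validly signed and correctly linked checkpoints and markers, with at least one ordinary checkpoint, where each ordinary checkpoint has a non-zero event count, accepted features, a valid $\mathsf{SWF}$ proof and a valid MAC. *Experiment.* The challenger generates the keys of the enclave and of the attestation hardware, the nonce and the quote. The adversary $\mathcal A$ gets the public values and controls the platform: adaptively, it presents input events of any origin to the channel, schedules checkpoints, crashes and restarts the enclave, and obtains quotes for other measurements. It receives all replies and, after each operation, a side-channel observation, whose law may depend on the complete state of the enclave and of the attestation hardware, secret keys included, and on an internal state of the side channel. Sealed storage and monotonic counters are ideal. $\mathcal A$ wins if it outputs $E^*$ with $\mathsf{Verify}(pk,E^*)=1$ without genuine input through the enclave, that is, unless the checkpoints of $E^*$ are exactly the first ones issued by the enclave, in order, and each of them that is not a recovery marker was computed from a non-empty batch of events whose origins the channel certifies (for the hardware-bound tier: genuine human events). $\mathrm{Adv}^{\mathrm{trust\text{-}inv}}_{\Pi_{\mathrm{TEE}},\mathcal A}(\lambda)$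 is the probability that $\mathcal A$ wins. *Leakage.* The side-channel leakage to $\mathcal A$ is bounded by $\epsilon_{\mathrm{sc}}(\lambda)$ if some efficient stateful simulator, given only the public values, the operations, their arguments and their replies, generates observations such that for every $\lambda$ the view of the session (public values, issued checkpoints with the events from which they were computed, transcript with observations, output of $\mathcal A$) is within statistical distance $\epsilon_{\mathrm{sc}}(\lambda)$ of the view with the real observations. *Claim.* Suppose that the enclave's signature scheme is existentially unforgeable under chosen-message attack against efficient forgers. Then for every input tier, every side channel and every efficient $\mathcal A$ to which the leakage is bounded by $\epsilon_{\mathrm{sc}}$, $$\mathrm{Adv}^{\mathrm{trust\text{-}inv}}_{\Pi_{\mathrm{TEE}},\mathcal A}(\lambda)\le \epsilon_{\mathrm{sc}}(\lambda)+\mathrm{negl}(\lambda)\qquad\text{for all }\lambda .$$ -/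

import Mathlib

namespace ProcAtt

/-! ### Data, polynomial bounds, negligible functions -/

/-- Bit strings. Tuples `List Word` are the messages exchanged, hashed and signed, so that the
concatenation of fields is unambiguous. -/
abbrev Word := List Bool

/-- Bit length of a tuple of bit strings, one separator per component. -/
def tupleLength (ws : List Word) : ℕ := (ws.map (fun w => w.length + 1)).sum

/-- `f` is bounded by a polynomial. -/
def PolyBounded (f : ℕ → ℕ) : Prop := ∃ p : Polynomial ℕ, ∀ n, f n ≤ p.eval n

/-- `ν` is negligible: `n ^ k * ν n → 0` for every `k`. -/
def Negligible (ν : ℕ → ℝ) : Prop :=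
  Asymptotics.SuperpolynomialDecay Filter.atTop (fun n : ℕ => (n : ℝ)) ν

/-- A uniformly random word of `n` bits. -/
noncomputable def uniformWord (n : ℕ) : PMF Word :=
  (PMF.uniformOfFintype (Fin n → Bool)).map List.ofFn

/-! ### Probabilistic oracle programs

Loop-free probabilistic register programs with oracle access. A polynomial-size family of them, one
program for each security parameter, is a non-uniform probabilistic polynomial-time oracle
algorithm. Apart from oracle answers, one instruction makes the longest tuple and the longest word
present longer by at most one, and every instruction is executed at most once, so the size of a
program bounds its running time. -/

/-- Registers hold tuples of bit strings. -/
abbrev Regs := ℕ → List Word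

/-- Programs with oracle calls named by `Op`. -/
inductive Prog (Op : Type) : Type where
  /-- do nothing -/
  | skip : Prog Op
  /-- sequential composition -/
  | seq : Prog Op → Prog Op → Prog Op
  /-- empty register `r` -/
  | clear (r : ℕ) : Prog Op
  /-- put the empty word in front of register `r` -/
  | newWord (r : ℕ) : Prog Op
  /-- put a bit in front of the first word of register `r` -/
  | pushBit (b : Bool) (r : ℕ) : Prog Op
  /-- put a fair random bit in front of the first word of register `r` -/
  | flip (r : ℕ) : Prog Op
  /-- delete the first bit of the first word of register `r` -/
  | popBit (r : ℕ) : Prog Op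
  /-- put the first word of register `s` in front of register `r` -/
  | pushWord (s r : ℕ) : Prog Op
  /-- delete the first word of register `r` -/
  | popWord (r : ℕ) : Prog Op
  /-- copy register `s` to register `r` -/
  | copy (s r : ℕ) : Prog Op
  /-- branch on register `r`: no word, first word empty, first bit `0`, first bit `1` -/
  | branch (r : ℕ) (noWord emptyWord zero one : Prog Op) : Prog Op
  /-- run `body` as a subroutine on fresh registers `0, 1, …` loaded from the registers `ins`, and
  store its registers `0, 1, …` in the registers `outs` -/
  | call (body : Prog Op) (ins outs : List ℕ) : Prog Op
  /-- query the oracle with the contents of register `s`, answer to register `r` -/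
  | ask (o : Op) (s r : ℕ) : Prog Op

namespace Prog

/-- Size of a program, which bounds the number of instructions executed. -/
def size {Op : Type} : Prog Op → ℕ
  | seq p q => p.size + q.size + 1
  | branch _ a b c d => a.size + b.size + c.size + d.size + 1
  | call p ins outs => p.size + ins.length + outs.length + 1
  | _ => 1

end Prog

/-- Replace the first word of a tuple, if there is one. -/
def mapHead (f : Word → Word) : List Word → List Word
  | [] => []
  | w :: ws => f w :: ws

/-- Registers `0, 1, …` loaded with the given tuples, all others empty. -/
def loadRegs (ins : List (List Word)) : Regs := fun i => ins.getD i []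

/-- Return from a subroutine: register `outs[j]` receives register `j` of the callee. -/
def storeRegs (outs : List ℕ) (callee caller : Regs) : Regs :=
  fun r => if r ∈ outs then callee (outs.idxOf r) else caller r

/-- A stateful probabilistic oracle. -/
abbrev Oracle (Op σ : Type) := Op → List Word → σ → PMF (List Word × σ)

namespace Prog

/-- Joint law of the final registers and the final oracle state. -/
noncomputable def eval {Op σ : Type} (O : Oracle Op σ) :
    Prog Op → Regs × σ → PMF (Regs × σ)
  | skip, x => pure x
  | seq p q, x => (p.eval O x).bind (q.eval O)
  | clear r, x => pure (Function.update x.1 r [], x.2)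
  | newWord r, x => pure (Function.update x.1 r ([] :: x.1 r), x.2)
  | pushBit b r, x => pure (Function.update x.1 r (mapHead (List.cons b) (x.1 r)), x.2)
  | flip r, x => (PMF.uniformOfFintype Bool).map
      (fun b => (Function.update x.1 r (mapHead (List.cons b) (x.1 r)), x.2))
  | popBit r, x => pure (Function.update x.1 r (mapHead List.tail (x.1 r)), x.2)
  | pushWord s r, x => pure (Function.update x.1 r ((x.1 s).headD [] :: x.1 r), x.2)
  | popWord r, x => pure (Function.update x.1 r (x.1 r).tail, x.2)
  | copy s r, x => pure (Function.update x.1 r (x.1 s), x.2)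
  | branch r a b c d, x =>
      match x.1 r with
      | [] => a.eval O x
      | [] :: _ => b.eval O x
      | (false :: _) :: _ => c.eval O x
      | (true :: _) :: _ => d.eval O x
  | call p ins outs, x => (p.eval O (loadRegs (ins.map x.1), x.2)).map
      (fun y => (storeRegs outs y.1 x.1, y.2))
  | ask o s r, x => (O o (x.1 s) x.2).map (fun y => (Function.update x.1 r y.1, y.2))

/-- Final registers of an oracle-free program started on the given inputs. -/
noncomputable def run (P : Prog Empty) (ins : List (List Word)) : PMF Regs :=
  (P.eval (σ := Unit) (fun o => nomatch o) (loadRegs ins, ())).map Prod.fst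

end Prog

/-- A family of programs of polynomial size. -/
def PolySize {Op : Type} (P : ℕ → Prog Op) : Prop := PolyBounded (fun n => (P n).size)

/-- The randomized algorithm `f` is (non-uniformly) polynomial-time: for inputs of any polynomial
length it is computed by polynomial-size programs. -/
def PPT (f : ℕ → List Word → PMF (List Word)) : Prop :=
  ∀ ℓ : ℕ → ℕ, PolyBounded ℓ → ∃ P : ℕ → Prog Empty, PolySize P ∧
    ∀ n ws, tupleLength ws ≤ ℓ n → ((P n).run [ws]).map (fun R => R 0) = f n ws

/-- A deterministic polynomial-time function with digests of polynomial length in `n`, however long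
the input is. -/
def PolyDigest (f : ℕ → List Word → Word) : Prop :=
  PPT (fun n ws => pure [f n ws]) ∧
    ∃ ℓ : ℕ → ℕ, PolyBounded ℓ ∧ ∀ n ws, (f n ws).length ≤ ℓ n

/-! ### Signature schemes -/

/-- A signature scheme; `keyGen` returns (secret key, public key). -/
structure SigScheme where
  keyGen : ℕ → PMF (Word × Word)
  sign : ℕ → Word → List Word → PMF Word
  verify : ℕ → Word → List Word → Word → Bool

namespace SigScheme

/-- The three algorithms are polynomial-time. -/
def Efficient (S : SigScheme) : Prop :=
  PPT (fun n _ => (S.keyGen n).map (fun k => [k.1, k.2])) ∧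
  PPT (fun n ws => match ws with
    | sk :: m => (S.sign n sk m).map (fun s => [s])
    | [] => pure []) ∧
  PPT (fun n ws => match ws with
    | pk :: s :: m => pure [[S.verify n pk m s]]
    | _ => pure [])

/-- The signing oracle, which remembers the messages it has signed. -/
noncomputable def signOracle (S : SigScheme) (n : ℕ) (sk : Word) : Oracle Unit (List (List Word)) :=
  fun _ m signed => (S.sign n sk m).map (fun s => ([s], signed ++ [m]))

/-- The chosen-message forgery experiment: the forger receives `pk` in register `0` and leaves the
message in register `0` and the signature in register `1`. It succeeds if the signature is valid and
the message was never signed by the oracle. -/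
noncomputable def forgeExp (S : SigScheme) (F : ℕ → Prog Unit) (n : ℕ) : PMF Bool :=
  (S.keyGen n).bind fun k =>
    ((F n).eval (S.signOracle n k.1) (loadRegs [[k.2]], [])).map fun x =>
      S.verify n k.2 (x.1 0) ((x.1 1).headD []) && decide (x.1 0 ∉ x.2)

/-- Existential unforgeability under chosen-message attack. -/
def EUFCMA (S : SigScheme) : Prop :=
  ∀ F : ℕ → Prog Unit, PolySize F → Negligible (fun n => (S.forgeExp F n true).toReal)

end SigScheme

/-! ### The protocol -/

/-- Where an input event presented to the enclave really comes from. -/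
inductive InputOrigin where
  /-- a human acting on the physical input device -/
  | device
  /-- posted at the input hooks of the operating system -/
  | osHook
  /-- written by the application into the channel -/
  | application

/-- The graded assurance of the input channel. -/
inductive InputTier where
  | software
  | osMediated
  | hardwareBound

/-- The origins from which a channel of the given tier lets events pass. At the hardware-bound tier
these are exactly the genuine human input events; a software channel cannot tell origins apart. -/
def InputTier.certifies : InputTier → InputOrigin → Bool
  | .software, _ => true
  | .osMediated, .application => false
  | .osMediated, _ => true
  | .hardwareBound, .device => true
  | .hardwareBound, _ => false

/-- The ingredients of the protocol. -/
structure Protocol where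
  /-- tier of the input channel -/
  tier : InputTier
  /-- signature scheme of the enclave -/
  sig : SigScheme
  /-- attestation scheme of the hardware: quotes are signatures under the attestation key -/
  att : SigScheme
  /-- identity (code measurement) of the enclave -/
  measurement : Word
  /-- hash function -/
  hash : ℕ → List Word → Word
  /-- message authentication code (key, message) -/
  mac : ℕ → Word → List Word → Word
  /-- sequential work function: seed to output -/
  swfOut : ℕ → List Word → Word
  /-- sequential work function: seed to proof -/
  swfProof : ℕ → List Word → Word
  /-- verification of the sequential work function: seed, output, proof -/
  swfCheck : ℕ → List Word → Word → Word → Bool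
  /-- behavioural features of a batch of events -/
  features : ℕ → List Word → Word
  /-- acceptance of behavioural features by the verifier (entropy thresholds and the like) -/
  policy : ℕ → Word → Bool
  /-- size of the fixed-size fields: events, gap durations, report data -/
  fieldLen : ℕ → ℕ

/-- Everything that the enclave and the hardware compute is polynomial-time. -/
structure Protocol.Efficient (Pi : Protocol) : Prop where
  sig : Pi.sig.Efficient
  att : Pi.att.Efficient
  hash : PolyDigest Pi.hash
  mac : PolyDigest (fun n ws => Pi.mac n (ws.headD []) ws.tail)
  swfOut : PolyDigest Pi.swfOut
  swfProof : PolyDigest Pi.swfProof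
  features : PolyDigest Pi.features
  fieldLen : PolyBounded Pi.fieldLen

/-- Numbers are written in unary. -/
def unary (k : ℕ) : Word := List.replicate k true

/-- A checkpoint: its position, whether it is a recovery marker, the hash of its predecessor, the
content digest, behavioural features, number of events, output and proof of the sequential work
function, and the tag that binds the three domains. A recovery marker carries the gap duration in
place of the content digest, and nothing after it. -/
structure Checkpoint where
  index : Word
  marker : Bool
  prev : Word
  content : Word
  behaviour : Word
  count : Word
  work : Word
  workProof : Word
  tag : Word

/-- The tuple that is hashed and signed. -/
def Checkpoint.words (C : Checkpoint) : List Word :=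
  [C.index, [C.marker], C.prev, C.content, C.behaviour, C.count, C.work, C.workProof, C.tag]

/-- A checkpoint issued by the enclave with the input events from which it was computed. -/
structure LogEntry where
  checkpoint : Checkpoint
  events : List (InputOrigin × Word)

/-- State of the enclave and of the attestation hardware. The record `issued` of all checkpoints
issued so far gives the monotonic counter, as its length. Sealed storage holds everything except
`buffer`, the events received since the last checkpoint. -/
structure Enclave where
  sk : Word
  pk : Word
  attSk : Word
  attVk : Word
  nonce : Word
  quote : Word
  chainHash : Word
  content : Word
  work : Word
  buffer : List (InputOrigin × Word)
  issued : List LogEntry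

/-- What the party in control of the platform can make the trusted hardware do. -/
inductive EnclaveOp where
  /-- present an input event of the given origin to the input channel (argument: the event) -/
  | input (o : InputOrigin)
  /-- schedule the generation of a checkpoint -/
  | checkpoint
  /-- crash the enclave and restart it from sealed storage (argument: the gap duration) -/
  | restart
  /-- obtain a quote for some other enclave (arguments: its measurement, its report data) -/
  | foreignQuote

/-- Bit string naming an operation. -/
def EnclaveOp.code : EnclaveOp → Word
  | .input .device => unary 0
  | .input .osHook => unary 1
  | .input .application => unary 2
  | .checkpoint => unary 3
  | .restart => unary 4
  | .foreignQuote => unary 5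

namespace Protocol

variable (Pi : Protocol) (n : ℕ)

/-- Start of a session: hash chain and work chain start from the verifier's nonce. -/
def initEnclave (sk pk attSk attVk nonce quote : Word) : Enclave where
  sk := sk
  pk := pk
  attSk := attSk
  attVk := attVk
  nonce := nonce
  quote := quote
  chainHash := Pi.hash n [nonce]
  content := []
  work := nonce
  buffer := []
  issued := []

/-- The checkpoint that the enclave computes from the events received since the last one. -/
def nextCheckpoint (e : Enclave) : Checkpoint :=
  let events := e.buffer.map Prod.snd
  let c := Pi.hash n (e.content :: events)
  let b := Pi.features n events
  let seed := [e.work, e.chainHash, c, b]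
  let y := Pi.swfOut n seed
  let p := Pi.swfProof n seed
  { index := unary (e.issued.length + 1)
    marker := false
    prev := e.chainHash
    content := c
    behaviour := b
    count := unary events.length
    work := y
    workProof := p
    tag := Pi.mac n y [c, b, p] }

/-- The recovery marker issued after a restart. -/
def recoveryMarker (e : Enclave) (gap : Word) : Checkpoint where
  index := unary (e.issued.length + 1)
  marker := true
  prev := e.chainHash
  content := gap
  behaviour := []
  count := []
  work := []
  workProof := []
  tag := []

/-- One operation of the trusted hardware: reply and new state. -/
noncomputable def enclaveStep (op : EnclaveOp) (args : List Word) (e : Enclave) :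
    PMF (List Word × Enclave) :=
  match op with
  | .input o =>
      pure ([], if Pi.tier.certifies o then
          { e with buffer := e.buffer ++ [(o, (args.headD []).take (Pi.fieldLen n))] }
        else e)
  | .checkpoint =>
      let C := Pi.nextCheckpoint n e
      (Pi.sig.sign n e.sk C.words).map fun s =>
        (C.words ++ [s],
          { e with
            chainHash := Pi.hash n C.words
            content := C.content
            work := C.work
            buffer := []
            issued := e.issued ++ [⟨C, e.buffer⟩] })
  | .restart =>
      let C := recoveryMarker e ((args.headD []).take (Pi.fieldLen n))
      (Pi.sig.sign n e.sk C.words).map fun s =>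
        (C.words ++ [s],
          { e with
            chainHash := Pi.hash n C.words
            buffer := []
            issued := e.issued ++ [⟨C, []⟩] })
  | .foreignQuote =>
      let m := (args.headD []).take Pi.measurement.length
      if m = Pi.measurement then pure ([[]], e)
      else (Pi.att.sign n e.attSk [m, (args.getD 1 []).take (Pi.fieldLen n)]).map
        fun q => ([q], e)

end Protocol

/-- A checkpoint with a signature. -/
structure SignedCheckpoint where
  checkpoint : Checkpoint
  signature : Word

/-- Read a sequence of signed checkpoints, ten words each. -/
def parseChain : List Word → Option (List SignedCheckpoint)
  | [] => some []
  | i :: [m] :: h :: c :: b :: k :: y :: p :: t :: s :: rest =>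
      (parseChain rest).map (fun ch => ⟨⟨i, m, h, c, b, k, y, p, t⟩, s⟩ :: ch)
  | _ => none

namespace Protocol

variable (Pi : Protocol) (n : ℕ)

/-- Verification of a chain from position `i` on, after the predecessor hash `h` and the work output
`y`. -/
def verifyChain (pk : Word) : ℕ → Word → Word → List SignedCheckpoint → Bool
  | _, _, _, [] => true
  | i, h, y, X :: rest =>
      let C := X.checkpoint
      Pi.sig.verify n pk C.words X.signature &&
      decide (C.index = unary i) && decide (C.prev = h) &&
      (if C.marker then
        verifyChain pk (i + 1) (Pi.hash n C.words) y rest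
      else
        decide (C.count ≠ []) && Pi.policy n C.behaviour &&
        Pi.swfCheck n [y, h, C.content, C.behaviour] C.work C.workProof &&
        decide (C.tag = Pi.mac n C.work [C.content, C.behaviour, C.workProof]) &&
        verifyChain pk (i + 1) (Pi.hash n C.words) C.work rest)

/-- The verifier. Evidence is a quote followed by a chain; the quote must bind `pk` to the enclave,
and the chain must be valid and contain a checkpoint other than a recovery marker. -/
def verify (nonce pk attVk : Word) : List Word → Bool
  | [] => false
  | q :: rest =>
      match parseChain rest with
      | none => false
      | some ch =>
          Pi.att.verify n attVk [Pi.measurement, pk] q &&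
          ch.any (fun X => !X.checkpoint.marker) &&
          Pi.verifyChain n pk 1 (Pi.hash n [nonce]) nonce ch

/-- The evidence reflects genuine input through the enclave: its checkpoints are the first ones that
the enclave issued, and each of them that is not a recovery marker was computed from a non-empty
batch of events, all of an origin that the input channel certifies. -/
def Genuine (issued : List LogEntry) (evidence : List Word) : Prop :=
  ∃ ch, parseChain evidence.tail = some ch ∧
    ch.map SignedCheckpoint.checkpoint = (issued.take ch.length).map LogEntry.checkpoint ∧
    ∀ x ∈ issued.take ch.length, x.checkpoint.marker = false →
      x.events ≠ [] ∧ ∀ ev ∈ x.events, Pi.tier.certifies ev.1 = true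

end Protocol

/-! ### Side channels and the experiment -/

/-- A side channel: after every operation the adversary observes a tuple drawn from a law that may
depend on the complete state of the enclave before and after it, on the operation, its arguments and
reply, and on an internal (microarchitectural) state. The initial state may depend on the public
values of the session. -/
structure SideChannel where
  State : Type
  init : ℕ → List Word → State
  observe : ℕ → State → Enclave → Enclave → EnclaveOp → List Word → List Word →
    PMF (List Word × State)

/-- A side channel without access to the enclave: the observations are generated by programs that
see only the public values of the session, the operations, their arguments and replies. -/
noncomputable def simulatedChannel (S : ℕ → Prog Empty) : SideChannel where
  State := List Word
  init := fun _ pub => pub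
  observe := fun n mem _ _ op args reply =>
    ((S n).run [mem, op.code :: args, reply]).map (fun R => (R 1, R 0))

/-- One exchange between the adversary and the trusted hardware. -/
structure Interaction where
  op : EnclaveOp
  args : List Word
  reply : List Word
  leak : List Word

/-- State of the experiment. -/
structure World (St : Type) where
  enclave : Enclave
  channel : St
  transcript : List Interaction

/-- What remains when the experiment is over: public values, checkpoints issued by the enclave, the
adversary's transcript, and the adversary's output. -/
structure View where
  nonce : Word
  pk : Word
  attVk : Word
  quote : Word
  issued : List LogEntry
  transcript : List Interaction
  output : List Word

namespace Protocol

variable (Pi : Protocol) (n : ℕ)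

/-- The adversary's access to the trusted hardware: the answer is the reply followed by the
side-channel observation. -/
noncomputable def teeOracle (L : SideChannel) : Oracle EnclaveOp (World L.State) :=
  fun op args w =>
    (Pi.enclaveStep n op args w.enclave).bind fun x =>
      (L.observe n w.channel w.enclave x.2 op args x.1).map fun l =>
        (x.1 ++ l.1,
          { enclave := x.2
            channel := l.2
            transcript := w.transcript ++ [⟨op, args, x.1, l.1⟩] })

/-- The trust inversion experiment with side channel `L`: key generation, quote for `pk`, nonce of
the verifier; then the adversary runs on the public values (register `0`), schedules and feeds the
enclave as it likes, and leaves its evidence in register `0`. -/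
noncomputable def trustInvExp (L : SideChannel) (A : ℕ → Prog EnclaveOp) : PMF View :=
  (Pi.sig.keyGen n).bind fun k =>
  (Pi.att.keyGen n).bind fun a =>
  (uniformWord n).bind fun nonce =>
  (Pi.att.sign n a.1 [Pi.measurement, k.2]).bind fun quote =>
    let pub := [nonce, k.2, a.2, quote]
    ((A n).eval (Pi.teeOracle n L)
      (loadRegs [pub],
        { enclave := Pi.initEnclave n k.1 k.2 a.1 a.2 nonce quote
          channel := L.init n pub
          transcript := [] })).map fun x =>
      { nonce := nonce
        pk := k.2
        attVk := a.2
        quote := quote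
        issued := x.2.enclave.issued
        transcript := x.2.transcript
        output := x.1 0 }

/-- The adversary wins if its evidence verifies without genuine input through the enclave. -/
def Wins (v : View) : Prop :=
  Pi.verify n v.nonce v.pk v.attVk v.output = true ∧ ¬ Pi.Genuine v.issued v.output

/-- The adversary's advantage: its probability of winning. -/
noncomputable def trustInvAdv (L : SideChannel) (A : ℕ → Prog EnclaveOp) : ℝ :=
  ((Pi.trustInvExp n L A).toOuterMeasure {v | Pi.Wins n v}).toReal

/-- The side-channel leakage to `A` is bounded by `ε`: it can be generated efficiently without
access to the enclave, up to statistical distance `ε n` of the resulting views of the session. -/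
def LeakageBounded (L : SideChannel) (A : ℕ → Prog EnclaveOp) (ε : ℕ → ℝ) : Prop :=
  ∃ S : ℕ → Prog Empty, PolySize S ∧ ∀ (n : ℕ) (T : Set View),
    |((Pi.trustInvExp n L A).toOuterMeasure T).toReal -
      ((Pi.trustInvExp n (simulatedChannel S) A).toOuterMeasure T).toReal| ≤ ε n

end Protocol

end ProcAtt

namespace ProcAtt

/-! ### Polynomial bounds -/

/-! Winning is an event on the view, so replacing the real side channel by its simulator `S` changes
the advantage by at most `ε n`. With simulated observations, the enclave's secret key enters the
experiment only through the signatures on issued checkpoints. A program with a signing oracle can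
therefore play the whole experiment: it draws the attestation keys, the nonce and the quote itself,
keeps the rest of the enclave state in registers, and runs `S` after each operation. `eval_simulate`
shows that this reproduces the law of the experiment exactly, and the messages recorded by the
signing oracle are exactly the tuples of the issued checkpoints.

A winning view contains a forgery (`exists_forgesAt`). Suppose that every checkpoint of verified
evidence had been issued. The enclave writes its counter into each checkpoint and the verifier
checks positions, so the checkpoint at a given position is the one issued at that position, and the
evidence is a prefix of the issued record. A non-zero count forces a non-empty batch, and the
channel lets only certified origins into the buffer. Hence the evidence is genuine. Signatures cover
the fields themselves rather than a digest, so equality of signed tuples is equality of checkpoints.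

The forger must name the offending checkpoint. Non-uniformity allows the best position to be fixed
for each `n`; the union bound in `trustInvAdv_le` costs a factor `N n`, a polynomial bound on the
length of the evidence, and a polynomial times a negligible function is negligible.

Most of the work is to show that the forger has polynomial size. The ingredients have programs only
for inputs of polynomial length, so every tuple that occurs must be bounded. Replies of the enclave
have a size independent of their arguments, because fields are truncated and digests are bounded,
and each run of `S` adds at most its own size. The growth per instruction is thus additive
(`growth`), with no compounding over the queries (`teeOracle_valid`). -/

theorem PolyBounded.of_le {f g : ℕ → ℕ} (hg : PolyBounded g) (h : ∀ n, f n ≤ g n) :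
    PolyBounded f := by
  obtain ⟨p, hp⟩ := hg
  exact ⟨p, fun n => (h n).trans (hp n)⟩

theorem polyBounded_const (c : ℕ) : PolyBounded fun _ => c := ⟨Polynomial.C c, fun n => by simp⟩

theorem polyBounded_id : PolyBounded fun n => n := ⟨Polynomial.X, fun n => by simp⟩

theorem PolyBounded.add {f g : ℕ → ℕ} (hf : PolyBounded f) (hg : PolyBounded g) :
    PolyBounded fun n => f n + g n := by
  obtain ⟨p, hp⟩ := hf
  obtain ⟨q, hq⟩ := hg
  exact ⟨p + q, fun n => by simpa using add_le_add (hp n) (hq n)⟩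

theorem PolyBounded.mul {f g : ℕ → ℕ} (hf : PolyBounded f) (hg : PolyBounded g) :
    PolyBounded fun n => f n * g n := by
  obtain ⟨p, hp⟩ := hf
  obtain ⟨q, hq⟩ := hg
  exact ⟨p * q, fun n => by simpa using Nat.mul_le_mul (hp n) (hq n)⟩

/-! ### Length and width of tuples -/

/-- The tuple has at most `m` words, each of at most `m` bits. -/
def Fits (m : ℕ) (ws : List Word) : Prop := ws.length ≤ m ∧ ∀ w ∈ ws, w.length ≤ m

theorem Fits.mono {m k : ℕ} {ws : List Word} (h : Fits m ws) (hk : m ≤ k) : Fits k ws :=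
  ⟨h.1.trans hk, fun w hw => (h.2 w hw).trans hk⟩

theorem fits_nil (m : ℕ) : Fits m [] := by simp [Fits]

theorem Fits.cons {m : ℕ} {w : Word} {ws : List Word} (h : Fits m ws) (hw : w.length ≤ m + 1) :
    Fits (m + 1) (w :: ws) := by
  refine ⟨by simpa using h.1, fun v hv => ?_⟩
  rcases List.mem_cons.1 hv with rfl | hv
  · exact hw
  · exact (h.2 v hv).trans (Nat.le_succ m)

theorem Fits.tail {m : ℕ} {ws : List Word} (h : Fits m ws) : Fits m ws.tail :=
  ⟨by simpa using h.1.trans (Nat.le_succ m), fun w hw => h.2 w (List.mem_of_mem_tail hw)⟩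

theorem Fits.headD {m : ℕ} {ws : List Word} (h : Fits m ws) : (ws.headD []).length ≤ m := by
  cases ws with
  | nil => simp
  | cons w ws => exact h.2 w (by simp)

theorem Fits.mapHead {m k : ℕ} {ws : List Word} {f : Word → Word} (h : Fits m ws) (hk : m ≤ k)
    (hf : ∀ w, w.length ≤ m → (f w).length ≤ k) : Fits k (mapHead f ws) := by
  cases ws with
  | nil => exact fits_nil k
  | cons w ws =>
    refine ⟨h.1.trans hk, fun v hv => ?_⟩
    rcases List.mem_cons.1 hv with rfl | hv
    · exact hf w (h.2 w (by simp))
    · exact (h.2 v (by simp [hv])).trans hk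

/-- Number of words and width each grow by at most one per instruction, whereas copying words can
double the total length. Bounds are therefore tracked by `Fits` and turned into lengths only here,
at a quadratic cost. -/
theorem Fits.tupleLength_le {m : ℕ} {ws : List Word} (h : Fits m ws) :
    tupleLength ws ≤ m * (m + 1) := by
  have := List.sum_le_card_nsmul (ws.map fun w => w.length + 1) (m + 1) (by
    intro x hx
    obtain ⟨w, hw, rfl⟩ := List.mem_map.1 hx
    exact Nat.succ_le_succ (h.2 w hw))
  rw [List.length_map, smul_eq_mul] at this
  exact this.trans (Nat.mul_le_mul_right _ h.1)

theorem fits_tupleLength (ws : List Word) : Fits (tupleLength ws) ws := by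
  induction ws with
  | nil => exact fits_nil _
  | cons w ws ih =>
    have h : tupleLength (w :: ws) = w.length + 1 + tupleLength ws := by simp [tupleLength]
    rw [h]
    exact (ih.mono (Nat.le_add_left _ w.length)).cons (by omega) |>.mono (by omega)

theorem fits_loadRegs {m : ℕ} {ins : List (List Word)} (h : ∀ ws ∈ ins, Fits m ws) (r : ℕ) :
    Fits m (loadRegs ins r) := by
  unfold loadRegs
  by_cases hr : r < ins.length
  · rw [List.getD_eq_getElem _ _ hr]
    exact h _ (List.getElem_mem hr)
  · rw [List.getD_eq_default _ _ (by omega)]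
    exact fits_nil m

/-! ### Invariants of programs -/

/-- A bound on the registers and a property of the oracle state, both indexed by the number of
instructions executed, persist along a program if the oracle maintains them. -/
theorem Prog.eval_invariant {Op σ : Type} (O : Oracle Op σ) (b : ℕ → ℕ)
    (hb : ∀ t, b t + 1 ≤ b (t + 1)) (T : ℕ) (J : ℕ → σ → Prop)
    (hJ : ∀ t s, J t s → J (t + 1) s)
    (hO : ∀ t, t < T → ∀ o a s, Fits (b t) a → J t s →
      ∀ y ∈ (O o a s).support, Fits (b (t + 1)) y.1 ∧ J (t + 1) y.2)
    (p : Prog Op) : ∀ t x, t + p.size ≤ T → (∀ r, Fits (b t) (x.1 r)) → J t x.2 →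
      ∀ y ∈ (p.eval O x).support, (∀ r, Fits (b (t + p.size)) (y.1 r)) ∧ J (t + p.size) y.2 := by
  have hbm : Monotone b := monotone_nat_of_le_succ fun t => (Nat.le_succ _).trans (hb t)
  have hJm : ∀ {t u s}, t ≤ u → J t s → J u s := by
    intro t u s htu h
    induction htu with
    | refl => exact h
    | step _ ih => exact hJ _ _ ih
  have upd : ∀ (t : ℕ) (R : Regs) (r : ℕ) (v : List Word), (∀ r, Fits (b t) (R r)) →
      Fits (b (t + 1)) v → ∀ i, Fits (b (t + 1)) (Function.update R r v i) := by
    intro t R r v hR hv i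
    by_cases hi : i = r
    · subst hi; simpa using hv
    · simpa [hi] using (hR i).mono (hbm (Nat.le_succ t))
  induction p with
  | skip =>
    intro t x _ hR hs y hy
    obtain rfl := (PMF.mem_support_pure_iff _ _).1 hy
    exact ⟨fun r => (hR r).mono (hbm (Nat.le_succ t)), hJ _ _ hs⟩
  | seq p q ihp ihq =>
    intro t x ht hR hs y hy
    obtain ⟨z, hz, hy⟩ := (PMF.mem_support_bind_iff _ _ _).1 hy
    simp only [size] at ht
    obtain ⟨h1, h2⟩ := ihp t x (by omega) hR hs z hz
    obtain ⟨h3, h4⟩ := ihq _ z (by omega) h1 h2 y hy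
    exact ⟨fun r => (h3 r).mono (hbm (by simp only [size]; omega)),
      hJm (by simp only [size]; omega) h4⟩
  | clear r =>
    intro t x _ hR hs y hy
    obtain rfl := (PMF.mem_support_pure_iff _ _).1 hy
    exact ⟨upd t _ _ _ hR (fits_nil _), hJ _ _ hs⟩
  | newWord r =>
    intro t x _ hR hs y hy
    obtain rfl := (PMF.mem_support_pure_iff _ _).1 hy
    exact ⟨upd t _ _ _ hR (((hR r).cons (by simp)).mono (hb t)), hJ _ _ hs⟩
  | pushBit c r =>
    intro t x _ hR hs y hy
    obtain rfl := (PMF.mem_support_pure_iff _ _).1 hy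
    exact ⟨upd t _ _ _ hR ((hR r).mapHead (hbm (Nat.le_succ t)) fun w hw => by
      have := hb t; simp; omega), hJ _ _ hs⟩
  | flip r =>
    intro t x _ hR hs y hy
    obtain ⟨c, _, rfl⟩ := (PMF.mem_support_map_iff _ _ _).1 hy
    exact ⟨upd t _ _ _ hR ((hR r).mapHead (hbm (Nat.le_succ t)) fun w hw => by
      have := hb t; simp; omega), hJ _ _ hs⟩
  | popBit r =>
    intro t x _ hR hs y hy
    obtain rfl := (PMF.mem_support_pure_iff _ _).1 hy
    exact ⟨upd t _ _ _ hR ((hR r).mapHead (hbm (Nat.le_succ t)) fun w hw => by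
      have := hb t; simp; omega), hJ _ _ hs⟩
  | pushWord s r =>
    intro t x _ hR hs y hy
    obtain rfl := (PMF.mem_support_pure_iff _ _).1 hy
    exact ⟨upd t _ _ _ hR (((hR r).cons ((hR s).headD.trans (Nat.le_succ _))).mono (hb t)),
      hJ _ _ hs⟩
  | popWord r =>
    intro t x _ hR hs y hy
    obtain rfl := (PMF.mem_support_pure_iff _ _).1 hy
    exact ⟨upd t _ _ _ hR ((hR r).tail.mono (hbm (Nat.le_succ t))), hJ _ _ hs⟩
  | copy s r =>
    intro t x _ hR hs y hy
    obtain rfl := (PMF.mem_support_pure_iff _ _).1 hy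
    exact ⟨upd t _ _ _ hR ((hR s).mono (hbm (Nat.le_succ t))), hJ _ _ hs⟩
  | branch r p1 p2 p3 p4 ih1 ih2 ih3 ih4 =>
    intro t x ht hR hs y hy
    simp only [size] at ht
    -- Only one arm runs, but the clock advances by the size of all four; monotonicity absorbs the
    -- difference.
    have key : ∀ q : Prog Op, q.size ≤ p1.size + p2.size + p3.size + p4.size →
        ((∀ r, Fits (b (t + q.size)) (y.1 r)) ∧ J (t + q.size) y.2) →
        (∀ r, Fits (b (t + (branch r p1 p2 p3 p4).size)) (y.1 r)) ∧
          J (t + (branch r p1 p2 p3 p4).size) y.2 := fun q hq h =>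
      ⟨fun r => (h.1 r).mono (hbm (by simp only [size]; omega)),
        hJm (by simp only [size]; omega) h.2⟩
    simp only [eval] at hy
    split at hy
    · exact key p1 (by omega) (ih1 t x (by omega) hR hs y hy)
    · exact key p2 (by omega) (ih2 t x (by omega) hR hs y hy)
    · exact key p3 (by omega) (ih3 t x (by omega) hR hs y hy)
    · exact key p4 (by omega) (ih4 t x (by omega) hR hs y hy)
  | call p ins outs ih =>
    intro t x ht hR hs y hy
    simp only [size] at ht
    obtain ⟨z, hz, rfl⟩ := (PMF.mem_support_map_iff _ _ _).1 hy
    obtain ⟨h1, h2⟩ := ih t (loadRegs (ins.map x.1), x.2) (by omega) (fits_loadRegs (by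
      intro ws hws
      obtain ⟨i, _, rfl⟩ := List.mem_map.1 hws
      exact hR i)) hs z hz
    refine ⟨fun r => ?_, hJm (by simp only [size]; omega) h2⟩
    simp only [storeRegs]
    split
    · exact (h1 _).mono (hbm (by simp only [size]; omega))
    · exact (hR r).mono (hbm (by simp only [size]; omega))
  | ask o s r =>
    intro t x ht hR hs y hy
    obtain ⟨z, hz, rfl⟩ := (PMF.mem_support_map_iff _ _ _).1 hy
    obtain ⟨h1, h2⟩ := hO t (by simp only [size] at ht; omega) o _ _ (hR s) hs z hz
    exact ⟨upd t _ _ _ hR h1, h2⟩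

theorem Prog.run_fits {m : ℕ} (P : Prog Empty) {ins : List (List Word)}
    (h : ∀ ws ∈ ins, Fits m ws) {R : Regs} (hR : R ∈ (P.run ins).support) (r : ℕ) :
    Fits (m + P.size) (R r) := by
  obtain ⟨z, hz, rfl⟩ := (PMF.mem_support_map_iff _ _ _).1 hR
  have := (P.eval_invariant _ (fun t => m + t) (fun t => le_rfl) P.size (fun _ _ => True)
    (fun _ _ h => h) (fun _ _ o => nomatch o) 0 _ (by simp) (fits_loadRegs h) trivial z hz).1 r
  simpa using this

/-- The output of a program exceeds its input by at most the size of the program. This bounds keys,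
signatures and quotes, for which efficiency states no length explicitly. -/
theorem PPT.exists_bound {f : ℕ → List Word → PMF (List Word)} (hf : PPT f) {ℓ : ℕ → ℕ}
    (hℓ : PolyBounded ℓ) : ∃ b : ℕ → ℕ, PolyBounded b ∧
      ∀ n ws, tupleLength ws ≤ ℓ n → ∀ v ∈ (f n ws).support, Fits (b n) v := by
  obtain ⟨P, hP, h⟩ := hf ℓ hℓ
  refine ⟨fun n => ℓ n + (P n).size, hℓ.add hP, fun n ws hws v hv => ?_⟩
  rw [← h n ws hws] at hv
  obtain ⟨R, hR, rfl⟩ := (PMF.mem_support_map_iff _ _ _).1 hv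
  exact (P n).run_fits (by simpa using (fits_tupleLength ws).mono hws) hR 0

theorem pmf_pure {α : Type} (a : α) : (pure a : PMF α) = PMF.pure a := rfl

namespace Prog

variable {Op σ : Type} (O : Oracle Op σ)

/-! ### Straight-line code and subroutines -/

/-- Use an oracle-free program in the presence of an oracle. -/
def embed : Prog Empty → Prog Op
  | skip => skip
  | seq p q => seq p.embed q.embed
  | clear r => clear r
  | newWord r => newWord r
  | pushBit b r => pushBit b r
  | flip r => flip r
  | popBit r => popBit r
  | pushWord s r => pushWord s r
  | popWord r => popWord r
  | copy s r => copy s r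
  | branch r a b c d => branch r a.embed b.embed c.embed d.embed
  | call p ins outs => call p.embed ins outs
  | ask o _ _ => nomatch o

theorem size_embed (p : Prog Empty) : (p.embed : Prog Op).size = p.size := by
  induction p with
  | ask o => exact nomatch o
  | _ => simp_all [embed, size]

theorem eval_embed (O' : Oracle Empty Unit) (p : Prog Empty) (R : Regs) (s : σ) :
    p.embed.eval O (R, s) = (p.eval O' (R, ())).map fun y => (y.1, s) := by
  induction p generalizing R with
  | ask o => exact nomatch o
  | seq p q ihp ihq =>
    simp only [embed, eval, ihp, PMF.map_bind, PMF.bind_map]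
    congr 1
    funext y
    exact ihq y.1
  | branch r a b c d iha ihb ihc ihd =>
    simp only [embed, eval]
    split <;> simp_all
  | call p ins outs ih =>
    simp only [embed, eval, ih, PMF.map_comp]
    rfl
  | flip r =>
    simp only [embed, eval, PMF.map_comp]
    rfl
  | _ => simp [embed, eval, PMF.map, pmf_pure]

theorem eval_call_embed (P : Prog Empty) (ins outs : List ℕ) (R : Regs) (s : σ) :
    (call P.embed ins outs).eval O (R, s) =
      (P.run (ins.map R)).map fun y => (storeRegs outs y R, s) := by
  simp only [eval, run, eval_embed O (fun o => nomatch o), PMF.map_comp]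
  rfl

/-- Apply an oracle-free program to one register and keep its first result. -/
def compute (P : Prog Empty) (s r : ℕ) : Prog Op := call P.embed [s] [r]

theorem storeRegs_singleton (r : ℕ) (R' R : Regs) :
    storeRegs [r] R' R = Function.update R r (R' 0) := by
  funext i
  by_cases h : i = r <;> simp [storeRegs, h]

theorem eval_compute {P : Prog Empty} {s r : ℕ} {R : Regs} {μ : PMF (List Word)}
    (h : (P.run [R s]).map (fun R => R 0) = μ) (st : σ) :
    (compute P s r).eval O (R, st) = μ.map fun v => (Function.update R r v, st) := by
  rw [compute, eval_call_embed, ← h, PMF.map_comp]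
  simp only [List.map_cons, List.map_nil, storeRegs_singleton]
  rfl

theorem eval_compute_pure {P : Prog Empty} {s r : ℕ} {R : Regs} {v : List Word}
    (h : (P.run [R s]).map (fun R => R 0) = PMF.pure v) (st : σ) :
    (compute P s r).eval O (R, st) = PMF.pure (Function.update R r v, st) := by
  rw [eval_compute O h]
  exact PMF.pure_map _ _

/-- Execute a list of programs one after the other. -/
def block : List (Prog Op) → Prog Op
  | [] => skip
  | p :: ps => seq p (block ps)

theorem eval_block_nil (x : Regs × σ) : (block []).eval O x = PMF.pure x := rfl

theorem eval_block_cons (p : Prog Op) (ps : List (Prog Op)) (x : Regs × σ) :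
    (block (p :: ps)).eval O x = (p.eval O x).bind ((block ps).eval O) := rfl

theorem size_block (ps : List (Prog Op)) :
    (block ps).size = (ps.map fun p => p.size + 1).sum + 1 := by
  induction ps with
  | nil => rfl
  | cons p ps ih => simp only [block, size, ih, List.map_cons, List.sum_cons]; omega

/-- Push the first words of the registers `ss` on register `r`. -/
def pushAll (ss : List ℕ) (r : ℕ) : Prog Op :=
  match ss with
  | [] => skip
  | s :: ss => seq (pushAll ss r) (pushWord s r)

theorem size_pushAll (ss : List ℕ) (r : ℕ) :
    (pushAll ss r : Prog Op).size = 2 * ss.length + 1 := by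
  induction ss with
  | nil => rfl
  | cons s ss ih => simp only [pushAll, size, ih, List.length_cons]; omega

theorem eval_pushAll {ss : List ℕ} {r : ℕ} (h : r ∉ ss) (R : Regs) (st : σ) :
    (pushAll ss r).eval O (R, st) =
      PMF.pure (Function.update R r (ss.map (fun s => (R s).headD []) ++ R r), st) := by
  induction ss with
  | nil => simp [pushAll, eval, pmf_pure]
  | cons s ss ih =>
    have hs : s ≠ r := by rintro rfl; simp at h
    rw [pushAll, eval, ih (by simp_all)]
    refine (PMF.pure_bind _ _).trans ?_
    simp [eval, hs, pmf_pure]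

/-- Push a fixed word on register `r`. -/
def pushConst (w : Word) (r : ℕ) : Prog Op :=
  match w with
  | [] => newWord r
  | b :: w => seq (pushConst w r) (pushBit b r)

theorem size_pushConst (w : Word) (r : ℕ) :
    (pushConst w r : Prog Op).size = 2 * w.length + 1 := by
  induction w with
  | nil => rfl
  | cons b w ih => simp only [pushConst, size, ih, List.length_cons]; omega

theorem eval_pushConst (w : Word) (r : ℕ) (R : Regs) (st : σ) :
    (pushConst w r).eval O (R, st) = PMF.pure (Function.update R r (w :: R r), st) := by
  induction w with
  | nil => rfl
  | cons b w ih =>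
    rw [pushConst, eval, ih]
    refine (PMF.pure_bind _ _).trans ?_
    simp [eval, mapHead, pmf_pure]

/-! ### Moving words and bits -/

/-- Move up to `k` words from register `s` to register `r`, one by one. -/
def revOnto (s r : ℕ) : ℕ → Prog Op
  | 0 => skip
  | k + 1 => seq (branch s skip (seq (pushWord s r) (popWord s)) (seq (pushWord s r) (popWord s))
      (seq (pushWord s r) (popWord s))) (revOnto s r k)

theorem size_revOnto (s r k : ℕ) : (revOnto s r k : Prog Op).size = 12 * k + 1 := by
  induction k with
  | zero => rfl
  | succ k ih => simp only [revOnto, size, ih]; omega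

theorem eval_revOnto {s r : ℕ} (h : s ≠ r) (k : ℕ) (R : Regs) (st : σ) :
    (revOnto s r k).eval O (R, st) =
      PMF.pure (Function.update (Function.update R r (((R s).take k).reverse ++ R r)) s
        ((R s).drop k), st) := by
  induction k generalizing R with
  | zero => simp [revOnto, eval, pmf_pure]
  | succ k ih =>
    -- The branch serves only to stop at an exhausted register: `pushWord` from an empty one would
    -- push an empty word.
    have mv : (branch s skip (seq (pushWord s r) (popWord s)) (seq (pushWord s r) (popWord s))
        (seq (pushWord s r) (popWord s))).eval O (R, st) =
        PMF.pure (Function.update (Function.update R r (((R s).take 1).reverse ++ R r)) s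
          ((R s).drop 1), st) := by
      have mv' : ((pushWord s r).seq (popWord s)).eval O (R, st) =
          PMF.pure (Function.update (Function.update R r ((R s).headD [] :: R r)) s
            (R s).tail, st) := by
        rw [eval]
        refine (PMF.pure_bind _ _).trans ?_
        simp [eval, h, pmf_pure]
      rw [eval]
      split <;> rename_i hs <;> simp only at hs
      · simp [eval, hs, pmf_pure]
        simp [← hs]
      all_goals rw [mv']; simp [hs]
    rw [revOnto, eval, mv]
    refine (PMF.pure_bind _ _).trans ?_
    rw [ih]
    congr 2
    funext i
    rcases hs : R s with _ | ⟨w, ws⟩ <;> by_cases hi : i = s <;> by_cases hi' : i = r <;>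
      simp_all [h.symm]

/-- Move up to `k` bits from the first word of register `s` to the first word of register `r`, one
by one. -/
def moveBits (s r : ℕ) : ℕ → Prog Op
  | 0 => skip
  | k + 1 => seq (branch s skip skip (seq (popBit s) (pushBit false r))
      (seq (popBit s) (pushBit true r))) (moveBits s r k)

theorem size_moveBits (s r k : ℕ) : (moveBits s r k : Prog Op).size = 10 * k + 1 := by
  induction k with
  | zero => rfl
  | succ k ih => simp only [moveBits, size, ih]; omega

theorem eval_moveBits {s r : ℕ} (h : s ≠ r) (k : ℕ) {R : Regs} {w v : Word} {ws vs : List Word}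
    (hs : R s = w :: ws) (hr : R r = v :: vs) (st : σ) :
    (moveBits s r k).eval O (R, st) =
      PMF.pure (Function.update (Function.update R r (((w.take k).reverse ++ v) :: vs)) s
        (w.drop k :: ws), st) := by
  induction k generalizing R w v with
  | zero => simp [moveBits, eval, pmf_pure, ← hs, ← hr]
  | succ k ih =>
    rw [moveBits, eval]
    have mv : (branch s skip skip (seq (popBit s) (pushBit false r))
        (seq (popBit s) (pushBit true r))).eval O (R, st) =
        PMF.pure (Function.update (Function.update R r (((w.take 1).reverse ++ v) :: vs)) s
          (w.drop 1 :: ws), st) := by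
      rw [eval]
      rcases w with _ | ⟨b, w⟩
      · simp [eval, hs, pmf_pure]
        simp [← hs, ← hr]
      · cases b <;> simp only [hs, eval] <;> refine (PMF.pure_bind _ _).trans ?_ <;>
          simp [mapHead, pmf_pure, h.symm, hr, Function.update_comm h]
    rw [mv]
    refine (PMF.pure_bind _ _).trans ?_
    rw [ih (w := w.drop 1) (v := (w.take 1).reverse ++ v) (by simp) (by simp [h.symm])]
    congr 2
    funext i
    rcases w with _ | ⟨b, w⟩ <;> by_cases hi : i = s <;> by_cases hi' : i = r <;>
      simp_all [h.symm]

/-- Replace register `r` by the first `k` bits of the first word of register `s`. -/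
def takeWord (k s r : ℕ) : Prog Op :=
  call (block [pushWord 0 1, newWord 2, moveBits 1 2 k, clear 0, newWord 0, moveBits 2 0 k]) [s] [r]

theorem size_takeWord (k s r : ℕ) : (takeWord k s r : Prog Op).size = 20 * k + 16 := by
  simp [takeWord, size, size_block, size_moveBits]; omega

theorem eval_takeWord (k s r : ℕ) (R : Regs) (st : σ) :
    (takeWord k s r).eval O (R, st) =
      PMF.pure (Function.update R r [((R s).headD []).take k], st) := by
  rw [takeWord, eval]
  simp only [block, eval, pmf_pure, PMF.pure_bind]
  -- Each pass reverses the bits it moves; the second pass restores their order.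
  rw [eval_moveBits O (by decide) k (w := (R s).headD []) (ws := []) (v := []) (vs := [])
    (by simp [loadRegs]) (by simp [loadRegs])]
  simp only [PMF.pure_bind]
  rw [eval_moveBits O (by decide) k (w := (((R s).headD []).take k).reverse) (ws := []) (v := [])
    (vs := []) (by simp) (by simp)]
  simp only [PMF.pure_bind, PMF.pure_map]
  simp [storeRegs_singleton, List.take_of_length_le]

/-- Push a word on register `1` if the fixed word `w` is a prefix of the first word of register `0`,
which is consumed. -/
def prefixTest : Word → Prog Op
  | [] => newWord 1
  | true :: w => branch 0 skip skip skip (seq (popBit 0) (prefixTest w))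
  | false :: w => branch 0 skip skip (seq (popBit 0) (prefixTest w)) skip

theorem size_prefixTest (w : Word) : (prefixTest w : Prog Op).size = 6 * w.length + 1 := by
  induction w with
  | nil => rfl
  | cons b w ih => cases b <;> simp only [prefixTest, size, ih, List.length_cons] <;> omega

/-- What remains in register `0` depends on where the first mismatch occurs, so only register `1`
and the oracle state are described. -/
theorem eval_prefixTest (w v : Word) (vs : List Word) (R : Regs) (hR : R 0 = v :: vs)
    (h1 : R 1 = []) (st : σ) :
    ((prefixTest w).eval O (R, st)).map (fun y => (y.1 1, y.2)) =
      PMF.pure (if v.take w.length = w then [[]] else [], st) := by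
  induction w generalizing v R with
  | nil => simp [prefixTest, eval, h1, pmf_pure, PMF.pure_map]
  | cons b w ih =>
    have key : (((popBit 0).seq (prefixTest w)).eval O (R, st)).map (fun y => (y.1 1, y.2)) =
        PMF.pure (if v.tail.take w.length = w then [[]] else [], st) := by
      rw [eval, eval, pmf_pure, PMF.pure_bind]
      exact ih v.tail _ (by simp [hR, mapHead]) (by simp [h1])
    rcases v with _ | ⟨c, v⟩
    · cases b <;> simp only [prefixTest, eval, hR] <;> simp [h1, pmf_pure, PMF.pure_map]
    · cases b <;> cases c <;> simp only [prefixTest] <;> rw [eval] <;> simp only [hR]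
      · convert key using 3; split_ifs <;> simp_all
      · simp [h1, eval, pmf_pure, PMF.pure_map]
      · simp [h1, eval, pmf_pure, PMF.pure_map]
      · convert key using 3; split_ifs <;> simp_all

/-- Set register `r` to a non-empty tuple if `w` is a prefix of the first word of register `s`, and
clear it otherwise. -/
def testWord (w : Word) (s r : ℕ) : Prog Op :=
  call (block [pushWord 0 2, copy 2 0, prefixTest w, copy 1 0]) [s] [r]

theorem size_testWord (w : Word) (s r : ℕ) :
    (testWord w s r : Prog Op).size = 6 * w.length + 12 := by
  simp [testWord, size, size_block, size_prefixTest]; omega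

theorem eval_testWord (w : Word) (s r : ℕ) (R : Regs) (st : σ) :
    (testWord w s r).eval O (R, st) =
      PMF.pure (Function.update R r (if ((R s).headD []).take w.length = w then [[]] else []), st) := by
  rw [testWord, eval]
  simp only [block, eval, pmf_pure, PMF.pure_bind]
  -- The detour through register `2` turns an empty register into one holding a single empty word,
  -- so that the test always has a word to consume.
  have := eval_prefixTest O w ((R s).headD []) []
    (Function.update (Function.update (loadRegs [R s]) 2 [(R s).headD []]) 0 [(R s).headD []])
    (by simp) (by simp [loadRegs]) st
  simp only [List.map_cons, List.map_nil, storeRegs_singleton]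
  have h2 := congrArg (PMF.map fun y => (Function.update R r y.1, y.2)) this
  rw [PMF.map_comp, PMF.pure_map] at h2
  rw [← h2]
  simp only [PMF.map_bind, PMF.pure_map]
  simp [PMF.map, Function.comp_def, loadRegs]

/-! ### Random words -/

/-- Put `k` random bits in front of the first word of register `r`. -/
def flips (r : ℕ) : ℕ → Prog Op
  | 0 => skip
  | k + 1 => seq (flips r k) (flip r)

theorem size_flips (r k : ℕ) : (flips r k : Prog Op).size = 2 * k + 1 := by
  induction k with
  | zero => rfl
  | succ k ih => simp only [flips, size, ih]; omega

end Prog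

theorem uniformWord_apply (n : ℕ) (w : Word) :
    uniformWord n w = if w.length = n then ((2 : ENNReal) ^ n)⁻¹ else 0 := by
  rw [uniformWord, PMF.map_apply]
  split_ifs with h
  · subst h
    rw [tsum_eq_single w.get]
    · simp
    · intro f hf
      rw [if_neg]
      rintro h
      exact hf (List.ofFn_injective (by rw [List.ofFn_get, ← h]))
  · refine ENNReal.tsum_eq_zero.2 fun f => if_neg ?_
    rintro rfl
    simp at h

theorem uniformWord_zero : uniformWord 0 = PMF.pure [] := by
  ext w
  rw [uniformWord_apply]
  by_cases h : w = [] <;> simp [h]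

/-- A word `b :: w` arises only from the tail `w` and the bit `b`, so its mass is half that of `w`.
This is the recursion followed by `flips`. -/
theorem uniformWord_succ (n : ℕ) : uniformWord (n + 1) =
    (uniformWord n).bind fun w => (PMF.uniformOfFintype Bool).map fun b => b :: w := by
  ext w
  rw [uniformWord_apply, PMF.bind_apply]
  rcases w with _ | ⟨b, w⟩
  · simp [PMF.map_apply]
  · rw [tsum_eq_single w, uniformWord_apply]
    · simp only [List.length_cons, Nat.add_right_cancel_iff, PMF.map_apply]
      rw [tsum_eq_single b]
      · by_cases h : w.length = n
        · simp only [h, if_true, PMF.uniformOfFintype_apply, Fintype.card_bool]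
          rw [pow_succ, ENNReal.mul_inv (by simp) (by simp)]
          simp
        · simp [h]
      · intro c hc
        simp [hc.symm]
    · intro v hv
      rw [PMF.map_apply]
      simp [hv.symm]

theorem Prog.eval_flips {Op σ : Type} (O : Oracle Op σ) (r k : ℕ) {R : Regs} {vs : List Word}
    (hr : R r = [] :: vs) (st : σ) :
    (Prog.flips r k).eval O (R, st) =
      (uniformWord k).map fun w => (Function.update R r (w :: vs), st) := by
  induction k with
  | zero =>
    rw [uniformWord_zero, flips, eval, pmf_pure, PMF.pure_map, ← hr]
    simp
  | succ k ih =>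
    rw [flips, eval, ih, uniformWord_succ, PMF.bind_map, PMF.map_bind]
    congr 1
    funext w
    simp [eval, PMF.map_comp, Function.comp_def, mapHead]

/-! ### The enclave as a program with a signing oracle -/

/-- `P` computes the randomized function `f` on inputs of length at most `ℓ`. -/
def Prog.Computes (P : Prog Empty) (f : List Word → PMF (List Word)) (ℓ : ℕ) : Prop :=
  ∀ ws, tupleLength ws ≤ ℓ → (P.run [ws]).map (fun R => R 0) = f ws

/-- Programs for the ingredients of the protocol, correct on inputs of length at most `ℓ`. -/
structure Machines (Pi : Protocol) (n ℓ : ℕ) where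
  hash : Prog Empty
  mac : Prog Empty
  swfOut : Prog Empty
  swfProof : Prog Empty
  features : Prog Empty
  attKeyGen : Prog Empty
  attSign : Prog Empty
  hash_computes : hash.Computes (fun ws => pure [Pi.hash n ws]) ℓ
  mac_computes : mac.Computes (fun ws => pure [Pi.mac n (ws.headD []) ws.tail]) ℓ
  swfOut_computes : swfOut.Computes (fun ws => pure [Pi.swfOut n ws]) ℓ
  swfProof_computes : swfProof.Computes (fun ws => pure [Pi.swfProof n ws]) ℓ
  features_computes : features.Computes (fun ws => pure [Pi.features n ws]) ℓ
  attKeyGen_computes : attKeyGen.Computes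
    (fun _ => (Pi.att.keyGen n).map fun k => [k.1, k.2]) ℓ
  attSign_computes : attSign.Computes
    (fun ws => match ws with
      | sk :: m => (Pi.att.sign n sk m).map fun s => [s]
      | [] => pure []) ℓ

/-- Total size of the programs. -/
def Machines.size {Pi : Protocol} {n ℓ : ℕ} (M : Machines Pi n ℓ) : ℕ :=
  M.hash.size + M.mac.size + M.swfOut.size + M.swfProof.size + M.features.size +
    M.attKeyGen.size + M.attSign.size

theorem Protocol.Efficient.exists_machines {Pi : Protocol} (h : Pi.Efficient) {ℓ : ℕ → ℕ}
    (hℓ : PolyBounded ℓ) : ∃ M : ∀ n, Machines Pi n (ℓ n), PolyBounded fun n => (M n).size := by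
  obtain ⟨P1, hs1, h1⟩ := h.hash.1 ℓ hℓ
  obtain ⟨P2, hs2, h2⟩ := h.mac.1 ℓ hℓ
  obtain ⟨P3, hs3, h3⟩ := h.swfOut.1 ℓ hℓ
  obtain ⟨P4, hs4, h4⟩ := h.swfProof.1 ℓ hℓ
  obtain ⟨P5, hs5, h5⟩ := h.features.1 ℓ hℓ
  obtain ⟨P6, hs6, h6⟩ := h.att.1 ℓ hℓ
  obtain ⟨P7, hs7, h7⟩ := h.att.2.1 ℓ hℓ
  exact ⟨fun n => ⟨P1 n, P2 n, P3 n, P4 n, P5 n, P6 n, P7 n, h1 n, h2 n, h3 n, h4 n, h5 n, h6 n,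
    h7 n⟩, (((((hs1.add hs2).add hs3).add hs4).add hs5).add hs6).add hs7⟩

/-! ### Size bounds on the state and the messages of the enclave -/

/-- Everything of fixed size in the protocol has at most `d` bits. -/
structure Protocol.FixedSize (Pi : Protocol) (n d : ℕ) : Prop where
  hash : ∀ ws, (Pi.hash n ws).length ≤ d
  mac : ∀ k ws, (Pi.mac n k ws).length ≤ d
  swfOut : ∀ ws, (Pi.swfOut n ws).length ≤ d
  swfProof : ∀ ws, (Pi.swfProof n ws).length ≤ d
  features : ∀ ws, (Pi.features n ws).length ≤ d
  fieldLen : Pi.fieldLen n ≤ d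
  nonce : n ≤ d
  measurement : Pi.measurement.length ≤ d

theorem Protocol.Efficient.exists_fixedSize {Pi : Protocol} (h : Pi.Efficient) :
    ∃ d : ℕ → ℕ, PolyBounded d ∧ ∀ n, Pi.FixedSize n (d n) := by
  obtain ⟨d1, hd1, h1⟩ := h.hash.2
  obtain ⟨d2, hd2, h2⟩ := h.mac.2
  obtain ⟨d3, hd3, h3⟩ := h.swfOut.2
  obtain ⟨d4, hd4, h4⟩ := h.swfProof.2
  obtain ⟨d5, hd5, h5⟩ := h.features.2
  refine ⟨_, ((((((hd1.add hd2).add hd3).add hd4).add hd5).add h.fieldLen).add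
    polyBounded_id).add (polyBounded_const Pi.measurement.length), fun n => ⟨?_, ?_, ?_, ?_, ?_,
    by omega, by omega, by omega⟩⟩
  · intro ws; have := h1 n ws; omega
  · intro k ws; have := h2 n (k :: ws); simp only [List.headD_cons, List.tail_cons] at this; omega
  · intro ws; have := h3 n ws; omega
  · intro ws; have := h4 n ws; omega
  · intro ws; have := h5 n ws; omega

/-- Bounds on the state of the enclave after at most `t` operations. -/
structure Enclave.Small (d t : ℕ) (e : Enclave) : Prop where
  attSk : e.attSk.length ≤ d
  chainHash : e.chainHash.length ≤ d
  content : e.content.length ≤ d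
  work : e.work.length ≤ d
  buffer : e.buffer.length ≤ t
  events : ∀ ev ∈ e.buffer, ev.2.length ≤ d
  issued : e.issued.length ≤ t

namespace Enclave.Small

variable {Pi : Protocol} {n d t : ℕ} {e : Enclave}

theorem mono {u : ℕ} (h : e.Small d t) (hu : t ≤ u) : e.Small d u :=
  { h with buffer := h.buffer.trans hu, issued := h.issued.trans hu }

theorem fits_events (h : e.Small d t) : Fits (d + t) (e.buffer.map Prod.snd) := by
  refine ⟨by simpa using h.buffer.trans (by omega), fun w hw => ?_⟩
  obtain ⟨ev, hev, rfl⟩ := List.mem_map.1 hw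
  exact (h.events ev hev).trans (by omega)

theorem fits_content_events (h : e.Small d t) :
    Fits (d + t + 1) (e.content :: e.buffer.map Prod.snd) :=
  h.fits_events.cons (h.content.trans (by omega))

/-- There are nine fields, and only the unary position and event count grow with `t`. -/
theorem fits_nextCheckpoint (h : e.Small d t) (hd : Pi.FixedSize n d) :
    Fits (d + t + 9) (Pi.nextCheckpoint n e).words := by
  refine ⟨by simp [Checkpoint.words], ?_⟩
  have := h.chainHash
  have := h.buffer
  have := h.issued
  simp only [Checkpoint.words, Protocol.nextCheckpoint, List.mem_cons, List.not_mem_nil, or_false,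
    forall_eq_or_imp, forall_eq]
  refine ⟨by simp [unary]; omega, by simp, by omega, (hd.hash _).trans (by omega),
    (hd.features _).trans (by omega), by simp [unary]; omega, (hd.swfOut _).trans (by omega),
    (hd.swfProof _).trans (by omega), (hd.mac _ _).trans (by omega)⟩

theorem fits_recoveryMarker (h : e.Small d t) {gap : Word} (hg : gap.length ≤ d) :
    Fits (d + t + 9) (Protocol.recoveryMarker e gap).words := by
  refine ⟨by simp [Checkpoint.words], ?_⟩
  have := h.chainHash
  have := h.issued
  simp only [Checkpoint.words, Protocol.recoveryMarker, List.mem_cons, List.not_mem_nil, or_false,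
    forall_eq_or_imp, forall_eq]
  refine ⟨by simp [unary]; omega, by simp, by omega, by omega, by simp⟩

/-- One operation lengthens the buffer or the issued record by at most one. Every other bounded
field is unchanged or becomes a fresh digest, so `d` does not grow with time. -/
theorem step (h : e.Small d t) (hd : Pi.FixedSize n d) (op : EnclaveOp) (args : List Word)
    {x : List Word × Enclave} (hx : x ∈ (Pi.enclaveStep n op args e).support) :
    x.2.Small d (t + 1) := by
  cases op with
  | input o =>
    obtain rfl := (PMF.mem_support_pure_iff _ _).1 hx
    dsimp only
    split_ifs
    · refine { h.mono (Nat.le_succ t) with buffer := ?_, events := ?_ }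
      · simpa using h.buffer
      · intro ev hev
        rcases List.mem_append.1 hev with hev | hev
        · exact h.events ev hev
        · obtain rfl := List.mem_singleton.1 hev
          simpa using Or.inl hd.fieldLen
    · exact h.mono (Nat.le_succ t)
  | checkpoint =>
    obtain ⟨s, _, rfl⟩ := (PMF.mem_support_map_iff _ _ _).1 hx
    exact ⟨h.attSk, hd.hash _, hd.hash _, hd.swfOut _, by simp, by simp,
      by simpa using h.issued⟩
  | restart =>
    obtain ⟨s, _, rfl⟩ := (PMF.mem_support_map_iff _ _ _).1 hx
    exact ⟨h.attSk, hd.hash _, h.content, h.work, by simp, by simp, by simpa using h.issued⟩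
  | foreignQuote =>
    simp only [Protocol.enclaveStep] at hx
    split_ifs at hx
    · obtain rfl := (PMF.mem_support_pure_iff _ _).1 hx
      exact h.mono (Nat.le_succ t)
    · obtain ⟨s, _, rfl⟩ := (PMF.mem_support_map_iff _ _ _).1 hx
      exact h.mono (Nat.le_succ t)

end Enclave.Small

theorem Protocol.enclaveStep_sk {Pi : Protocol} {n : ℕ} {op : EnclaveOp} {args : List Word}
    {e : Enclave} {x : List Word × Enclave} (hx : x ∈ (Pi.enclaveStep n op args e).support) :
    x.2.sk = e.sk := by
  cases op with
  | input o =>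
    obtain rfl := (PMF.mem_support_pure_iff _ _).1 hx
    dsimp only
    split_ifs <;> rfl
  | checkpoint =>
    obtain ⟨s, _, rfl⟩ := (PMF.mem_support_map_iff _ _ _).1 hx
    rfl
  | restart =>
    obtain ⟨s, _, rfl⟩ := (PMF.mem_support_map_iff _ _ _).1 hx
    rfl
  | foreignQuote =>
    simp only [Protocol.enclaveStep] at hx
    split_ifs at hx
    · obtain rfl := (PMF.mem_support_pure_iff _ _).1 hx
      rfl
    · obtain ⟨s, _, rfl⟩ := (PMF.mem_support_map_iff _ _ _).1 hx
      rfl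

/-- The registers that represent the enclave, without its signing key, and the memory of a simulated
side channel. -/
def stateRegs (e : Enclave) (mem : List Word) : List (List Word) :=
  [[e.attSk], [e.chainHash], [e.content], [e.work], (e.buffer.map Prod.snd).reverse,
    [unary e.issued.length], mem, [unary e.buffer.length]]

/-- The messages that the enclave has signed. -/
def Enclave.signed (e : Enclave) : List (List Word) := e.issued.map fun x => x.checkpoint.words

/-- One operation of the enclave: the state is in registers `0` to `7`, the arguments are in
register `8`, which receives the reply. -/
def opBody {Pi : Protocol} {n ℓ : ℕ} (M : Machines Pi n ℓ) (t : ℕ) : EnclaveOp → Prog Unit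
  | .input o =>
      if Pi.tier.certifies o then
        .block [.takeWord (Pi.fieldLen n) 8 9, .pushWord 9 4, .pushBit true 7, .clear 8]
      else .block [.clear 8]
  | .checkpoint => .block
      [.copy 4 9, .revOnto 9 10 t, .compute M.features 10 12, .pushWord 2 10,
        .compute M.hash 10 11, .pushAll [3, 1, 11, 12] 13, .compute M.swfOut 13 14,
        .compute M.swfProof 13 15, .pushAll [14, 11, 12, 15] 16, .compute M.mac 16 17,
        .pushBit true 5, .pushConst [false] 18, .pushAll [5, 18, 1, 11, 12, 7, 14, 15, 17] 19,
        .ask () 19 8, .pushAll [5, 18, 1, 11, 12, 7, 14, 15, 17] 8, .compute M.hash 19 1,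
        .copy 11 2, .copy 14 3, .clear 4, .clear 7, .newWord 7]
  | .restart => .block
      [.takeWord (Pi.fieldLen n) 8 9, .pushBit true 5, .pushConst [true] 18, .newWord 10,
        .pushAll [5, 18, 1, 9, 10, 10, 10, 10, 10] 19, .ask () 19 8,
        .pushAll [5, 18, 1, 9, 10, 10, 10, 10, 10] 8, .compute M.hash 19 1, .clear 4, .clear 7,
        .newWord 7]
  | .foreignQuote => .block
      [.takeWord Pi.measurement.length 8 9, .testWord Pi.measurement 9 10, .popWord 8,
        .takeWord (Pi.fieldLen n) 8 12, .pushAll [0, 9, 12] 13,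
        .branch 10 (.compute M.attSign 13 8) (.seq (.clear 8) (.newWord 8)) .skip .skip]

/-- Registers beyond the list read as empty. Padding with empty tuples brings all scratch registers
into the list, as the evaluation rules below require. -/
theorem loadRegs_append_nil (l : List (List Word)) (k : ℕ) :
    loadRegs (l ++ List.replicate k []) = loadRegs l := by
  funext i
  simp only [loadRegs, List.getD_eq_getElem?_getD]
  by_cases hi : i < l.length
  · rw [List.getElem?_append_left hi]
  · rw [List.getElem?_append_right (by omega), List.getElem?_replicate,
      List.getElem?_eq_none (l := l) (by omega)]
    split_ifs <;> rfl

theorem update_loadRegs {l : List (List Word)} {i : ℕ} (h : i < l.length) (v : List Word) :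
    Function.update (loadRegs l) i v = loadRegs (l.set i v) := by
  funext j
  simp only [loadRegs, List.getD_eq_getElem?_getD, Function.update_apply]
  split_ifs with hj
  · subst hj; simp [h]
  · rw [List.getElem?_set_ne (Ne.symm hj)]

/-! ### Execution on a finite register file -/

namespace Prog

variable {Op σ : Type} {O : Oracle Op σ} {l : List (List Word)} {s r : ℕ} {st : σ}

theorem eval_block_of_pure {p : Prog Op} {ps : List (Prog Op)} {x y : Regs × σ}
    (h : p.eval O x = PMF.pure y) : (block (p :: ps)).eval O x = (block ps).eval O y := by
  rw [eval_block_cons, h, PMF.pure_bind]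

theorem load_copy (hr : r < l.length) : (copy s r).eval O (loadRegs l, st) =
    PMF.pure (loadRegs (l.set r (l.getD s [])), st) := by
  rw [← update_loadRegs hr]; rfl

theorem load_clear (hr : r < l.length) : (clear r).eval O (loadRegs l, st) =
    PMF.pure (loadRegs (l.set r []), st) := by
  rw [← update_loadRegs hr]; rfl

theorem load_newWord (hr : r < l.length) : (newWord r).eval O (loadRegs l, st) =
    PMF.pure (loadRegs (l.set r ([] :: l.getD r [])), st) := by
  rw [← update_loadRegs hr]; rfl

theorem load_pushBit {b : Bool} (hr : r < l.length) : (pushBit b r).eval O (loadRegs l, st) =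
    PMF.pure (loadRegs (l.set r (mapHead (List.cons b) (l.getD r []))), st) := by
  rw [← update_loadRegs hr]; rfl

theorem load_pushWord (hr : r < l.length) : (pushWord s r).eval O (loadRegs l, st) =
    PMF.pure (loadRegs (l.set r ((l.getD s []).headD [] :: l.getD r [])), st) := by
  rw [← update_loadRegs hr]; rfl

theorem load_popWord (hr : r < l.length) : (popWord r).eval O (loadRegs l, st) =
    PMF.pure (loadRegs (l.set r (l.getD r []).tail), st) := by
  rw [← update_loadRegs hr]; rfl

theorem load_pushConst {w : Word} (hr : r < l.length) : (pushConst w r).eval O (loadRegs l, st) =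
    PMF.pure (loadRegs (l.set r (w :: l.getD r [])), st) := by
  rw [← update_loadRegs hr, eval_pushConst]; rfl

theorem load_pushAll {ss : List ℕ} (h : r ∉ ss) (hr : r < l.length) :
    (pushAll ss r).eval O (loadRegs l, st) =
      PMF.pure (loadRegs (l.set r (ss.map (fun s => (l.getD s []).headD []) ++ l.getD r [])),
        st) := by
  rw [← update_loadRegs hr, eval_pushAll O h]; rfl

theorem load_revOnto {k : ℕ} (h : s ≠ r) (hs : s < l.length) (hr : r < l.length)
    (hk : (l.getD s []).length ≤ k) :
    (revOnto s r k).eval O (loadRegs l, st) =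
      PMF.pure (loadRegs ((l.set r ((l.getD s []).reverse ++ l.getD r [])).set s []), st) := by
  rw [← update_loadRegs (by simpa using hs), ← update_loadRegs hr, eval_revOnto O h]
  have h1 : (loadRegs l s).take k = l.getD s [] := List.take_of_length_le hk
  have h2 : (loadRegs l s).drop k = [] := List.drop_of_length_le hk
  rw [h1, h2]; rfl

theorem load_takeWord {k : ℕ} (hr : r < l.length) : (takeWord k s r).eval O (loadRegs l, st) =
    PMF.pure (loadRegs (l.set r [((l.getD s []).headD []).take k]), st) := by
  rw [← update_loadRegs hr, eval_takeWord]; rfl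

theorem load_testWord {w : Word} (hr : r < l.length) : (testWord w s r).eval O (loadRegs l, st) =
    PMF.pure (loadRegs (l.set r
      (if ((l.getD s []).headD []).take w.length = w then [[]] else [])), st) := by
  rw [← update_loadRegs hr, eval_testWord]; rfl

theorem load_branch_nil {a b c d : Prog Op} (hr : l.getD r [] = []) :
    (branch r a b c d).eval O (loadRegs l, st) = a.eval O (loadRegs l, st) := by
  rw [eval]
  simp only [show loadRegs l r = [] from hr]

theorem load_branch_emptyWord {a b c d : Prog Op} {ws : List Word} (hr : l.getD r [] = [] :: ws) :
    (branch r a b c d).eval O (loadRegs l, st) = b.eval O (loadRegs l, st) := by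
  rw [eval]
  simp only [show loadRegs l r = [] :: ws from hr]

theorem load_compute_map {P : Prog Empty} {f : List Word → PMF (List Word)} {ℓ : ℕ}
    {ws : List Word} (hP : P.Computes f ℓ) (h : tupleLength ws ≤ ℓ) (hs : l.getD s [] = ws)
    (hr : r < l.length) :
    (compute P s r).eval O (loadRegs l, st) = (f ws).map fun v => (loadRegs (l.set r v), st) := by
  subst hs
  rw [eval_compute O (hP _ h)]
  simp only [update_loadRegs hr]
  rfl

theorem load_compute {P : Prog Empty} {f : List Word → Word} {ℓ : ℕ} {ws : List Word}
    (hP : P.Computes (fun ws => pure [f ws]) ℓ) (h : tupleLength ws ≤ ℓ)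
    (hs : l.getD s [] = ws) (hr : r < l.length) :
    (compute P s r).eval O (loadRegs l, st) = PMF.pure (loadRegs (l.set r [f ws]), st) := by
  subst hs
  rw [← update_loadRegs hr, eval_compute_pure O (hP _ h)]; rfl

end Prog

/-! ### The register programs reproduce the law of each enclave operation -/

section

variable {Pi : Protocol} {n ℓ : ℕ} (M : Machines Pi n ℓ) {d t : ℕ} {e : Enclave}

theorem load_ask_sign {l : List (List Word)} {s r : ℕ} {sk : Word} {st : List (List Word)}
    (hr : r < l.length) :
    (Prog.ask () s r).eval (Pi.sig.signOracle n sk) (loadRegs l, st) =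
      (Pi.sig.sign n sk (l.getD s [])).map fun σ =>
        (loadRegs (l.set r [σ]), st ++ [l.getD s []]) := by
  rw [Prog.eval, SigScheme.signOracle, PMF.map_comp]
  congr 1
  funext σ
  simp only [Function.comp_apply, update_loadRegs hr]
  rfl

theorem unary_succ (k : ℕ) : unary (k + 1) = true :: unary k := rfl

-- Everything before the signature is deterministic register arithmetic; the only random choice is
-- the oracle's signature, which matches the one drawn by `enclaveStep`. Scratch registers are
-- forgotten, so only the first nine are compared.
open Prog in
theorem eval_opBody_checkpoint (hd : Pi.FixedSize n d) (he : e.Small d t)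
    (hℓ : (d + t + 9) * (d + t + 10) ≤ ℓ) (mem args : List Word) :
    ((opBody M t .checkpoint).eval (Pi.sig.signOracle n e.sk)
      (loadRegs (stateRegs e mem ++ [args]), e.signed)).map
        (fun y => ((List.range 9).map y.1, y.2)) =
      (Pi.enclaveStep n .checkpoint args e).map fun x =>
        (stateRegs x.2 mem ++ [x.1], x.2.signed) := by
  have len : ∀ {ws}, Fits (d + t + 9) ws → tupleLength ws ≤ ℓ := fun h =>
    h.tupleLength_le.trans hℓ
  have h1 := len (he.fits_events.mono (by omega))
  have h2 := len (he.fits_content_events.mono (by omega))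
  have h3 := len (he.fits_nextCheckpoint hd)
  have h4 : ∀ {a b c d' : Word}, a.length ≤ d → b.length ≤ d → c.length ≤ d → d'.length ≤ d →
      tupleLength [a, b, c, d'] ≤ ℓ := fun ha hb hc hd' =>
    len ⟨by simp, by
      simp only [List.mem_cons, List.not_mem_nil, or_false, forall_eq_or_imp, forall_eq]
      omega⟩
  -- Nine registers are given and the code uses `0` to `19`, hence eleven more.
  rw [← loadRegs_append_nil _ 11, opBody]
  simp only [stateRegs, List.cons_append, List.nil_append, List.replicate]
  rw [eval_block_of_pure (load_copy (by simp))]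
  -- Events are stored newest first, so that receiving one is a single push; reversal restores the
  -- order. The loop bound `t` suffices since the buffer has at most `t` events.
  rw [eval_block_of_pure (load_revOnto (by simp) (by simp) (by simp)
    (by simpa using he.buffer))]
  simp only [List.set, List.getD_cons_succ, List.getD_cons_zero, List.reverse_reverse,
    List.append_nil]
  rw [eval_block_of_pure (load_compute M.features_computes h1 (by rfl) (by simp))]
  rw [eval_block_of_pure (load_pushWord (by simp))]
  simp only [List.set, List.getD_cons_succ, List.getD_cons_zero, List.headD_cons]
  rw [eval_block_of_pure (load_compute M.hash_computes h2 (by rfl) (by simp))]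
  rw [eval_block_of_pure (load_pushAll (by simp) (by simp))]
  simp only [List.set, List.getD_cons_succ, List.getD_cons_zero, List.headD_cons, List.map_cons,
    List.map_nil, List.append_nil]
  rw [eval_block_of_pure (load_compute M.swfOut_computes
    (h4 he.work he.chainHash (hd.hash _) (hd.features _)) (by rfl) (by simp))]
  rw [eval_block_of_pure (load_compute M.swfProof_computes
    (h4 he.work he.chainHash (hd.hash _) (hd.features _)) (by rfl) (by simp))]
  rw [eval_block_of_pure (load_pushAll (by simp) (by simp))]
  simp only [List.set, List.getD_cons_succ, List.getD_cons_zero, List.headD_cons, List.map_cons,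
    List.map_nil, List.append_nil]
  rw [eval_block_of_pure (load_compute M.mac_computes
    (h4 (hd.swfOut _) (hd.hash _) (hd.features _) (hd.swfProof _)) (by rfl) (by simp))]
  rw [eval_block_of_pure (load_pushBit (by simp))]
  rw [eval_block_of_pure (load_pushConst (by simp))]
  rw [eval_block_of_pure (load_pushAll (by simp) (by simp))]
  simp only [List.set, List.getD_cons_succ, List.getD_cons_zero, List.headD_cons, List.map_cons,
    List.map_nil, List.append_nil, mapHead, ← unary_succ]
  rw [eval_block_cons, load_ask_sign (by simp), PMF.bind_map, PMF.map_bind, Protocol.enclaveStep,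
    PMF.map_comp]
  simp only [List.getD_cons_succ, List.getD_cons_zero, List.tail_cons]
  simp only [Checkpoint.words, Protocol.nextCheckpoint, List.length_map] at h3
  rw [PMF.map]
  congr 1
  · simp [Checkpoint.words, Protocol.nextCheckpoint]
  funext σ
  simp only [Function.comp_apply, List.set]
  -- Register `8` holds only the signature; pushing the nine fields in front completes the reply.
  rw [eval_block_of_pure (load_pushAll (by simp) (by simp))]
  simp only [List.set, List.getD_cons_succ, List.getD_cons_zero, List.headD_cons, List.map_cons,
    List.map_nil, List.cons_append, List.nil_append]
  rw [eval_block_of_pure (load_compute M.hash_computes h3 (by rfl) (by simp))]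
  rw [eval_block_of_pure (load_copy (by simp))]
  rw [eval_block_of_pure (load_copy (by simp))]
  rw [eval_block_of_pure (load_clear (by simp))]
  rw [eval_block_of_pure (load_clear (by simp))]
  rw [eval_block_of_pure (load_newWord (by simp))]
  rw [eval_block_nil, PMF.pure_map]
  simp [List.range_succ, loadRegs, Checkpoint.words, Protocol.nextCheckpoint, Enclave.signed]
  rfl

open Prog in
theorem eval_opBody_restart (hd : Pi.FixedSize n d) (he : e.Small d t)
    (hℓ : (d + t + 9) * (d + t + 10) ≤ ℓ) (mem args : List Word) :
    ((opBody M t .restart).eval (Pi.sig.signOracle n e.sk)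
      (loadRegs (stateRegs e mem ++ [args]), e.signed)).map
        (fun y => ((List.range 9).map y.1, y.2)) =
      (Pi.enclaveStep n .restart args e).map fun x =>
        (stateRegs x.2 mem ++ [x.1], x.2.signed) := by
  have h3 := (he.fits_recoveryMarker (gap := (args.headD []).take (Pi.fieldLen n))
    (by simpa using Or.inl hd.fieldLen)).tupleLength_le.trans hℓ
  rw [← loadRegs_append_nil _ 11, opBody]
  simp only [stateRegs, List.cons_append, List.nil_append, List.replicate]
  rw [eval_block_of_pure (load_takeWord (by simp))]
  rw [eval_block_of_pure (load_pushBit (by simp))]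
  rw [eval_block_of_pure (load_pushConst (by simp))]
  rw [eval_block_of_pure (load_newWord (by simp))]
  -- Register `10` holds one empty word and supplies the five empty fields of a marker.
  rw [eval_block_of_pure (load_pushAll (by simp) (by simp))]
  simp only [List.set, List.getD_cons_succ, List.getD_cons_zero, List.headD_cons, List.map_cons,
    List.map_nil, List.append_nil, mapHead, ← unary_succ]
  rw [eval_block_cons, load_ask_sign (by simp), PMF.bind_map, PMF.map_bind, Protocol.enclaveStep,
    PMF.map_comp]
  simp only [List.getD_cons_succ, List.getD_cons_zero]
  rw [PMF.map]
  simp only [Checkpoint.words, Protocol.recoveryMarker] at h3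
  congr 1
  funext σ
  simp only [Function.comp_apply, List.set]
  rw [eval_block_of_pure (load_pushAll (by simp) (by simp))]
  simp only [List.set, List.getD_cons_succ, List.getD_cons_zero, List.headD_cons, List.map_cons,
    List.map_nil, List.cons_append, List.nil_append]
  rw [eval_block_of_pure (load_compute M.hash_computes h3 (by rfl) (by simp))]
  rw [eval_block_of_pure (load_clear (by simp))]
  rw [eval_block_of_pure (load_clear (by simp))]
  rw [eval_block_of_pure (load_newWord (by simp))]
  rw [eval_block_nil, PMF.pure_map]
  simp [List.range_succ, loadRegs, Checkpoint.words, Protocol.recoveryMarker, Enclave.signed]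
  rfl

open Prog in
theorem eval_opBody_input (o : InputOrigin) (mem args : List Word) :
    ((opBody M t (.input o)).eval (Pi.sig.signOracle n e.sk)
      (loadRegs (stateRegs e mem ++ [args]), e.signed)).map
        (fun y => ((List.range 9).map y.1, y.2)) =
      (Pi.enclaveStep n (.input o) args e).map fun x =>
        (stateRegs x.2 mem ++ [x.1], x.2.signed) := by
  rw [← loadRegs_append_nil _ 1, opBody, Protocol.enclaveStep, pmf_pure, PMF.pure_map]
  simp only [stateRegs, List.cons_append, List.nil_append, List.replicate]
  split_ifs
  · rw [eval_block_of_pure (load_takeWord (by simp))]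
    rw [eval_block_of_pure (load_pushWord (by simp))]
    rw [eval_block_of_pure (load_pushBit (by simp))]
    rw [eval_block_of_pure (load_clear (by simp))]
    rw [eval_block_nil, PMF.pure_map]
    simp [List.range_succ, loadRegs, Enclave.signed, mapHead, unary_succ]
  · rw [eval_block_of_pure (load_clear (by simp))]
    rw [eval_block_nil, PMF.pure_map]
    simp [List.range_succ, loadRegs, Enclave.signed]

open Prog in
theorem eval_opBody_foreignQuote (hd : Pi.FixedSize n d) (he : e.Small d t)
    (hℓ : (d + t + 9) * (d + t + 10) ≤ ℓ) (mem args : List Word) :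
    ((opBody M t .foreignQuote).eval (Pi.sig.signOracle n e.sk)
      (loadRegs (stateRegs e mem ++ [args]), e.signed)).map
        (fun y => ((List.range 9).map y.1, y.2)) =
      (Pi.enclaveStep n .foreignQuote args e).map fun x =>
        (stateRegs x.2 mem ++ [x.1], x.2.signed) := by
  have h3 : tupleLength [e.attSk, (args.headD []).take Pi.measurement.length,
      (args.tail.headD []).take (Pi.fieldLen n)] ≤ ℓ := by
    have h1 := he.attSk
    have h2 := hd.fieldLen
    have h3 := hd.measurement
    refine (Fits.tupleLength_le (m := d + t + 9) ⟨by simp, ?_⟩).trans hℓ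
    simp only [List.mem_cons, List.not_mem_nil, or_false, forall_eq_or_imp, forall_eq,
      List.length_take]
    omega
  have hargs : args.getD 1 [] = args.tail.headD [] := by
    rcases args with _ | ⟨_, _ | ⟨_, _⟩⟩ <;> rfl
  rw [← loadRegs_append_nil _ 11, opBody]
  simp only [stateRegs, List.cons_append, List.nil_append, List.replicate]
  rw [eval_block_of_pure (load_takeWord (by simp))]
  -- Register `9` is already cut to the length of the measurement, so the prefix test decides
  -- equality.
  rw [eval_block_of_pure (load_testWord (by simp))]
  rw [eval_block_of_pure (load_popWord (by simp))]
  rw [eval_block_of_pure (load_takeWord (by simp))]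
  rw [eval_block_of_pure (load_pushAll (by simp) (by simp))]
  simp only [List.set, List.getD_cons_succ, List.getD_cons_zero, List.headD_cons, List.map_cons,
    List.map_nil, List.append_nil, List.take_take, min_self]
  rw [eval_block_cons, Protocol.enclaveStep, hargs]
  by_cases hm : (args.headD []).take Pi.measurement.length = Pi.measurement
  · simp only [hm, if_true]
    rw [load_branch_emptyWord (by rfl), Prog.eval, load_clear (by simp), PMF.pure_bind,
      load_newWord (by simp), PMF.pure_bind, eval_block_nil, PMF.pure_map, pmf_pure, PMF.pure_map]
    simp [List.range_succ, loadRegs, Enclave.signed]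
  · simp only [hm, if_false]
    rw [load_branch_nil (by rfl), load_compute_map M.attSign_computes h3 (by rfl) (by simp)]
    simp only [PMF.bind_map, PMF.map_bind, PMF.map_comp]
    rw [PMF.map]
    congr 1
    funext σ
    simp only [Function.comp_apply]
    rw [eval_block_nil, PMF.pure_map]
    simp [List.range_succ, loadRegs, Enclave.signed]

theorem eval_opBody (hd : Pi.FixedSize n d) (he : e.Small d t)
    (hℓ : (d + t + 9) * (d + t + 10) ≤ ℓ) (op : EnclaveOp) (mem args : List Word) :
    ((opBody M t op).eval (Pi.sig.signOracle n e.sk)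
      (loadRegs (stateRegs e mem ++ [args]), e.signed)).map
        (fun y => ((List.range 9).map y.1, y.2)) =
      (Pi.enclaveStep n op args e).map fun x =>
        (stateRegs x.2 mem ++ [x.1], x.2.signed) := by
  cases op with
  | input o => exact eval_opBody_input M o mem args
  | checkpoint => exact eval_opBody_checkpoint M hd he hℓ mem args
  | restart => exact eval_opBody_restart M hd he hℓ mem args
  | foreignQuote => exact eval_opBody_foreignQuote M hd he hℓ mem args

/-! ### One exchange with the simulated trusted hardware -/

/-- The answer to one oracle query of the adversary: the reply of the enclave, followed by an
observation generated by `S`. The state is in registers `0` to `7`, the arguments are in register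
`8`, which receives the answer. -/
def opHandler (M : Machines Pi n ℓ) (S : Prog Empty) (t : ℕ) (op : EnclaveOp) : Prog Unit :=
  .block [.copy 8 9, .pushConst op.code 9,
    .call (opBody M t op) [0, 1, 2, 3, 4, 5, 6, 7, 8] [0, 1, 2, 3, 4, 5, 6, 7, 8],
    .call S.embed [6, 9, 8] [6, 11], .copy 8 10, .revOnto 10 12 10, .copy 11 8,
    .revOnto 12 8 10]

/-- Nine fields and a signature are the longest reply. The constant is the loop bound in
`opHandler`. -/
theorem Protocol.length_reply_le {op : EnclaveOp} {args : List Word}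
    {x : List Word × Enclave} (hx : x ∈ (Pi.enclaveStep n op args e).support) :
    x.1.length ≤ 10 := by
  cases op with
  | input o =>
    obtain rfl := (PMF.mem_support_pure_iff _ _).1 hx
    simp
  | checkpoint =>
    obtain ⟨s, _, rfl⟩ := (PMF.mem_support_map_iff _ _ _).1 hx
    simp [Checkpoint.words]
  | restart =>
    obtain ⟨s, _, rfl⟩ := (PMF.mem_support_map_iff _ _ _).1 hx
    simp [Checkpoint.words]
  | foreignQuote =>
    simp only [Protocol.enclaveStep] at hx
    split_ifs at hx
    · obtain rfl := (PMF.mem_support_pure_iff _ _).1 hx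
      simp
    · obtain ⟨s, _, rfl⟩ := (PMF.mem_support_map_iff _ _ _).1 hx
      simp

/-- Restriction to the support is what makes invariants of reachable states available when two
experiments are compared draw by draw. -/
theorem pmf_bind_congr {α β : Type} {μ : PMF α} {f g : α → PMF β}
    (h : ∀ a ∈ μ.support, f a = g a) : μ.bind f = μ.bind g := by
  ext b
  simp only [PMF.bind_apply]
  refine tsum_congr fun a => ?_
  by_cases ha : μ a = 0
  · simp [ha]
  · rw [h a ((PMF.mem_support_iff _ _).2 ha)]

/-- The registers of a caller after a subroutine depend only on the registers that are returned. -/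
theorem Prog.eval_call_of_map {Op σ α : Type} {O : Oracle Op σ} {p : Prog Op} {ins outs : List ℕ}
    {R : Regs} {st : σ} {μ : PMF α} {g : α → List (List Word) × σ}
    (h : (p.eval O (loadRegs (ins.map R), st)).map
      (fun y => ((List.range outs.length).map y.1, y.2)) = μ.map g) :
    (call p ins outs).eval O (R, st) =
      μ.map fun a => (storeRegs outs (loadRegs (g a).1) R, (g a).2) := by
  have key : (fun a => (storeRegs outs (loadRegs (g a).1) R, (g a).2)) =
      (fun z : List (List Word) × σ => (storeRegs outs (loadRegs z.1) R, z.2)) ∘ g := rfl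
  rw [key, ← PMF.map_comp, ← h, PMF.map_comp, eval]
  congr 1
  funext y
  simp only [Function.comp_apply, Prod.mk.injEq, and_true]
  funext r
  simp only [storeRegs]
  split_ifs with hr
  · simp [loadRegs, List.getD_eq_getElem?_getD, List.idxOf_lt_length_iff.2 hr]
  · rfl

theorem storeRegs_pair {a b : ℕ} (h : a ≠ b) (R' R : Regs) :
    storeRegs [a, b] R' R = Function.update (Function.update R a (R' 0)) b (R' 1) := by
  funext i
  by_cases ha : i = a
  · subst ha; simp [storeRegs, h]
  · by_cases hb : i = b
    · subst hb; simp [storeRegs, h]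
    · simp [storeRegs, ha, hb]

-- The handler moves the reply to register `12` in reverse and back onto the observation, which
-- yields reply followed by observation. The transcript of the experiment has no counterpart in the
-- registers, since no answer depends on it.
open Prog in
theorem eval_opHandler (hd : Pi.FixedSize n d) (S : ℕ → Prog Empty)
    {w : World (List Word)} (he : w.enclave.Small d t)
    (hℓ : (d + t + 9) * (d + t + 10) ≤ ℓ) (op : EnclaveOp) (args : List Word) :
    ((opHandler M (S n) t op).eval (Pi.sig.signOracle n w.enclave.sk)
      (loadRegs (stateRegs w.enclave w.channel ++ [args]), w.enclave.signed)).map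
        (fun y => ((List.range 9).map y.1, y.2)) =
      (Pi.teeOracle n (simulatedChannel S) op args w).map fun x =>
        (stateRegs x.2.enclave x.2.channel ++ [x.1], x.2.enclave.signed) := by
  rw [← loadRegs_append_nil _ 5, opHandler]
  simp only [stateRegs, List.cons_append, List.nil_append, List.replicate]
  rw [eval_block_of_pure (load_copy (by simp))]
  rw [eval_block_of_pure (load_pushConst (by simp))]
  simp only [List.set, List.getD_cons_succ, List.getD_cons_zero]
  rw [eval_block_cons, eval_call_of_map (eval_opBody M hd he hℓ op w.channel args)]
  simp only [PMF.bind_map, PMF.map_bind, Protocol.teeOracle]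
  refine pmf_bind_congr fun x hx => ?_
  have hlen := Protocol.length_reply_le hx
  have h9 : ∀ v0 v1 v2 v3 v4 v5 v6 v7 v8 u0 u1 u2 u3 u4 u5 u6 u7 u8 : List Word,
      ∀ us : List (List Word), storeRegs [0, 1, 2, 3, 4, 5, 6, 7, 8]
        (loadRegs [v0, v1, v2, v3, v4, v5, v6, v7, v8])
        (loadRegs (u0 :: u1 :: u2 :: u3 :: u4 :: u5 :: u6 :: u7 :: u8 :: us)) =
      loadRegs (v0 :: v1 :: v2 :: v3 :: v4 :: v5 :: v6 :: v7 :: v8 :: us) := by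
    intros
    funext i
    match i with
    | 0 | 1 | 2 | 3 | 4 | 5 | 6 | 7 | 8 => rfl
    | i + 9 => simp [storeRegs, loadRegs]
  simp only [Function.comp_apply, stateRegs, List.cons_append, List.nil_append, h9]
  rw [eval_block_cons, eval_call_embed]
  simp only [storeRegs_pair (show (6 : ℕ) ≠ 11 by decide)]
  -- The state type of `simulatedChannel S` is `List Word` only after unfolding, so the observation
  -- law is restated up to definitional equality.
  have hrun : ∀ μ : PMF Regs, μ = (S n).run [w.channel, op.code :: args, x.1] →
      (simulatedChannel S).observe n w.channel w.enclave x.2 op args x.1 =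
        μ.map fun R => (R 1, R 0) := fun μ h => by rw [h]; rfl
  rw [hrun _ rfl]
  simp only [PMF.bind_map, PMF.map_bind]
  refine Eq.trans ?_ (congrArg _ (PMF.map_comp _ _ _)).symm
  refine Eq.trans ?_ (PMF.map_comp _ _ _).symm
  refine pmf_bind_congr fun R _ => ?_
  simp only [Function.comp_apply]
  rw [update_loadRegs (by simp), update_loadRegs (by simp)]
  simp only [List.set]
  rw [eval_block_of_pure (load_copy (by simp))]
  rw [eval_block_of_pure (load_revOnto (by simp) (by simp) (by simp) (by simpa using hlen))]
  rw [eval_block_of_pure (load_copy (by simp))]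
  rw [eval_block_of_pure (load_revOnto (by simp) (by simp) (by simp) (by simpa using hlen))]
  rw [eval_block_nil, PMF.pure_map]
  simp [List.range_succ, loadRegs]
  rfl

/-- The coefficient of `d` comes from a foreign quote: two truncations at `20` per bit and a prefix
test at `6`. The term `12 * t` is the reversal of the buffer. -/
theorem size_opBody_le (hd : Pi.FixedSize n d) (op : EnclaveOp) :
    (opBody M t op).size ≤ 6 * M.size + 46 * d + 12 * t + 400 := by
  have h1 := hd.fieldLen
  have h2 := hd.measurement
  cases op <;> simp only [opBody]
  case input =>
    split_ifs
    · simp [Prog.size_block, Prog.size, Prog.size_takeWord]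
      omega
    · simp [Prog.size_block, Prog.size]
  all_goals
    simp [Prog.size_block, Prog.size, Prog.size_takeWord, Prog.size_testWord, Prog.size_pushAll,
      Prog.size_pushConst, Prog.size_revOnto, Prog.compute, Prog.size_embed, Machines.size]
    omega

theorem size_opHandler_le (hd : Pi.FixedSize n d) (S : Prog Empty) (op : EnclaveOp) :
    (opHandler M S t op).size ≤ S.size + 6 * M.size + 46 * d + 12 * t + 1000 := by
  have h1 := size_opBody_le M (t := t) hd op
  have h2 : op.code.length ≤ 5 := by
    cases op with
    | input o => cases o <;> simp [EnclaveOp.code, unary]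
    | _ => simp [EnclaveOp.code, unary]
  simp [opHandler, Prog.size_block, Prog.size, Prog.size_pushConst, Prog.size_revOnto,
    Prog.size_embed]
  omega

end

/-- The adversary's access to the trusted hardware with simulated observations. -/
noncomputable def simOracle (Pi : Protocol) (n : ℕ) (S : ℕ → Prog Empty) :
    Oracle EnclaveOp (World (List Word)) :=
  Pi.teeOracle n (simulatedChannel S)

/-! ### The adversary as a program with a signing oracle -/

/-- Registers `0` to `7` loaded with `l`, followed by the registers `R`. -/
def prependRegs (l : List (List Word)) (R : Regs) : Regs :=
  fun i => if i < 8 then l.getD i [] else R (i - 8)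

/-- The simulated state that corresponds to a state of the experiment. -/
def encodeState (x : Regs × World (List Word)) : Regs × List (List Word) :=
  (prependRegs (stateRegs x.2.enclave x.2.channel) x.1, x.2.enclave.signed)

theorem prependRegs_add (l : List (List Word)) (R : Regs) (r : ℕ) :
    prependRegs l R (r + 8) = R r := by
  simp [prependRegs]

theorem update_prependRegs (l : List (List Word)) (R : Regs) (r : ℕ) (v : List Word) :
    Function.update (prependRegs l R) (r + 8) v = prependRegs l (Function.update R r v) := by
  funext i
  by_cases h : i < 8
  · simp [prependRegs, h, show i ≠ r + 8 by omega]
  · obtain ⟨j, rfl⟩ : ∃ j, i = j + 8 := ⟨i - 8, by omega⟩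
    simp [prependRegs, Function.update_apply]

theorem map_prependRegs {l : List (List Word)} (hl : l.length = 8) (R : Regs) (ins : List ℕ) :
    (List.range 8 ++ ins.map (· + 8)).map (prependRegs l R) = l ++ ins.map R := by
  rw [List.map_append, List.map_map]
  congr 1
  refine List.ext_getElem (by simp [hl]) fun i h1 h2 => ?_
  have : i < 8 := by simpa using h1
  simp [prependRegs, this, h2]

theorem loadRegs_append {l : List (List Word)} (hl : l.length = 8) (ins : List (List Word)) :
    loadRegs (l ++ ins) = prependRegs l (loadRegs ins) := by
  funext i
  simp only [loadRegs, prependRegs, List.getD_eq_getElem?_getD]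
  split_ifs with h
  · rw [List.getElem?_append_left (by omega)]
  · rw [List.getElem?_append_right (by omega), hl]

/-- A subroutine of the adversary starts on fresh registers, but the enclave must persist through
it: the state of the callee replaces that of the caller, while the adversary's registers follow the
usual return convention. -/
theorem storeRegs_prependRegs {l l' : List (List Word)} (outs : List ℕ) (R' R : Regs) :
    storeRegs (List.range 8 ++ outs.map (· + 8)) (prependRegs l' R') (prependRegs l R) =
      prependRegs l' (storeRegs outs R' R) := by
  have hinj : Function.Injective fun r : ℕ => r + 8 := add_left_injective 8
  funext i
  by_cases h : i < 8
  · have hmem : i ∈ List.range 8 := List.mem_range.2 h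
    simp only [storeRegs, List.mem_append, hmem, true_or, if_true]
    rw [List.idxOf_append_of_mem hmem]
    have : (List.range 8).idxOf i = i := by
      interval_cases i <;> rfl
    rw [this]
    simp [prependRegs, h]
  · obtain ⟨j, rfl⟩ : ∃ j, i = j + 8 := ⟨i - 8, by omega⟩
    have hmem : j + 8 ∉ List.range 8 := by simp
    have hmem' : j + 8 ∈ outs.map (· + 8) ↔ j ∈ outs := by simp
    simp only [storeRegs, List.mem_append, hmem, false_or, hmem', prependRegs_add]
    split_ifs with hj
    · rw [List.idxOf_append_of_notMem hmem]
      have hidx : (outs.map (· + 8)).idxOf (j + 8) = outs.idxOf j := by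
        clear hmem' hj
        induction outs with
        | nil => rfl
        | cons a outs ih => simp [List.idxOf_cons, ih]
      rw [hidx, List.length_range, add_comm, prependRegs_add]
    · rfl

section

variable {Pi : Protocol} {n ℓ : ℕ} (M : Machines Pi n ℓ)

/-- The program that runs an adversary against the simulated trusted hardware. Register `r` of the
adversary becomes register `r + 8`. -/
def simulate (S : Prog Empty) (T : ℕ) : Prog EnclaveOp → Prog Unit
  | .skip => .skip
  | .seq p q => .seq (simulate S T p) (simulate S T q)
  | .clear r => .clear (r + 8)
  | .newWord r => .newWord (r + 8)
  | .pushBit b r => .pushBit b (r + 8)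
  | .flip r => .flip (r + 8)
  | .popBit r => .popBit (r + 8)
  | .pushWord s r => .pushWord (s + 8) (r + 8)
  | .popWord r => .popWord (r + 8)
  | .copy s r => .copy (s + 8) (r + 8)
  | .branch r a b c d => .branch (r + 8) (simulate S T a) (simulate S T b) (simulate S T c)
      (simulate S T d)
  | .call p ins outs => .call (simulate S T p) (List.range 8 ++ ins.map (· + 8))
      (List.range 8 ++ outs.map (· + 8))
  | .ask op s r => .call (opHandler M S T op) (List.range 8 ++ [s].map (· + 8))
      (List.range 8 ++ [r].map (· + 8))

/-- Each instruction expands by a factor independent of the adversary's code apart from its size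
bound `T`. A query is the worst case: the handler, nine registers in, nine out, and the call itself.
-/
theorem size_simulate_le {d T : ℕ} (hd : Pi.FixedSize n d) (S : Prog Empty)
    (p : Prog EnclaveOp) : (simulate M S T p).size ≤
      p.size * (S.size + 6 * M.size + 46 * d + 12 * T + 1020) := by
  obtain ⟨K, hK⟩ : ∃ K, K = S.size + 6 * M.size + 46 * d + 12 * T + 1020 := ⟨_, rfl⟩
  rw [← hK]
  have h1 : 1 ≤ K := by omega
  induction p with
  | seq p q ihp ihq => simp only [simulate, Prog.size, add_mul]; omega
  | branch r a b c d iha ihb ihc ihd => simp only [simulate, Prog.size, add_mul]; omega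
  | call p ins outs ih =>
    simp only [simulate, Prog.size, add_mul, List.length_append, List.length_map,
      List.length_range]
    have h2 : ins.length ≤ ins.length * K := Nat.le_mul_of_pos_right _ h1
    have h3 : outs.length ≤ outs.length * K := Nat.le_mul_of_pos_right _ h1
    omega
  | ask op s r =>
    have := size_opHandler_le M (t := T) hd S op
    simp only [simulate, Prog.size, List.length_append, List.length_map,
      List.length_range, List.length_singleton]
    omega
  | _ => simp only [simulate, Prog.size]; omega

end

/-! ### Invariants of the experiment -/

/-- What the enclave guarantees about the checkpoints that it has issued. -/
structure Enclave.Certified (Pi : Protocol) (e : Enclave) : Prop where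
  buffer : ∀ ev ∈ e.buffer, Pi.tier.certifies ev.1 = true
  index : ∀ (i : ℕ) (h : i < e.issued.length), e.issued[i].checkpoint.index = unary (i + 1)
  count : ∀ x ∈ e.issued, x.checkpoint.marker = false → x.checkpoint.count ≠ [] → x.events ≠ []
  events : ∀ x ∈ e.issued, ∀ ev ∈ x.events, Pi.tier.certifies ev.1 = true

/-- The position written into a checkpoint is the current counter plus one, its count is the unary
length of the batch, and the buffer is fed only through the filter of the tier. -/
theorem Enclave.Certified.step {Pi : Protocol} {n : ℕ} {e : Enclave} (h : e.Certified Pi)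
    {op : EnclaveOp} {args : List Word} {x : List Word × Enclave}
    (hx : x ∈ (Pi.enclaveStep n op args e).support) : x.2.Certified Pi := by
  cases op with
  | input o =>
    obtain rfl := (PMF.mem_support_pure_iff _ _).1 hx
    dsimp only
    split_ifs with ho
    · refine { h with buffer := fun ev hev => ?_ }
      rcases List.mem_append.1 hev with hev | hev
      · exact h.buffer ev hev
      · obtain rfl := List.mem_singleton.1 hev
        exact ho
    · exact h
  | checkpoint =>
    obtain ⟨s, _, rfl⟩ := (PMF.mem_support_map_iff _ _ _).1 hx
    refine ⟨by simp, fun i hi => ?_, fun y hy hm hc => ?_, fun y hy => ?_⟩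
    · dsimp only
      rw [List.getElem_append]
      split_ifs with hlt
      · exact h.index i hlt
      · have : i = e.issued.length := by simp at hi; omega
        subst this
        simp [Protocol.nextCheckpoint]
    · rcases List.mem_append.1 hy with hy | hy
      · exact h.count y hy hm hc
      · obtain rfl := List.mem_singleton.1 hy
        rintro h0
        simp only at h0
        simp [Protocol.nextCheckpoint, h0, unary] at hc
    · rcases List.mem_append.1 hy with hy | hy
      · exact h.events y hy
      · obtain rfl := List.mem_singleton.1 hy
        exact h.buffer
  | restart =>
    obtain ⟨s, _, rfl⟩ := (PMF.mem_support_map_iff _ _ _).1 hx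
    refine ⟨by simp, fun i hi => ?_, fun y hy hm hc => ?_, fun y hy => ?_⟩
    · dsimp only
      rw [List.getElem_append]
      split_ifs with hlt
      · exact h.index i hlt
      · have : i = e.issued.length := by simp at hi; omega
        subst this
        simp [Protocol.recoveryMarker]
    · rcases List.mem_append.1 hy with hy | hy
      · exact h.count y hy hm hc
      · obtain rfl := List.mem_singleton.1 hy
        simp [Protocol.recoveryMarker] at hm
    · rcases List.mem_append.1 hy with hy | hy
      · exact h.events y hy
      · obtain rfl := List.mem_singleton.1 hy
        simp
  | foreignQuote =>
    simp only [Protocol.enclaveStep] at hx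
    split_ifs at hx
    · obtain rfl := (PMF.mem_support_pure_iff _ _).1 hx
      exact h
    · obtain ⟨s, _, rfl⟩ := (PMF.mem_support_map_iff _ _ _).1 hx
      exact h

/-- Signatures and quotes of tuples that fit `m` have at most `q` bits. -/
def Protocol.SignaturesBounded (Pi : Protocol) (n m q : ℕ) : Prop :=
  ∀ k ws, Fits m (k :: ws) →
    (∀ s ∈ (Pi.sig.sign n k ws).support, s.length ≤ q) ∧
      ∀ s ∈ (Pi.att.sign n k ws).support, s.length ≤ q

/-- Arguments are truncated before use, so the bound does not involve their size. This prevents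
sizes from compounding when replies are fed back as arguments. -/
theorem Enclave.Small.fits_reply {Pi : Protocol} {n d t q : ℕ} {e : Enclave} (h : e.Small d t)
    (hd : Pi.FixedSize n d) (hq : Pi.SignaturesBounded n (d + t + 10) q) (hsk : e.sk.length ≤ d)
    {op : EnclaveOp} {args : List Word} {x : List Word × Enclave}
    (hx : x ∈ (Pi.enclaveStep n op args e).support) : Fits (d + t + q + 10) x.1 := by
  have sig : ∀ ws, Fits (d + t + 9) ws → ∀ s ∈ (Pi.sig.sign n e.sk ws).support,
      Fits (d + t + q + 10) (ws ++ [s]) := fun ws hws s hs => by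
    have hs := (hq e.sk ws (hws.cons (by omega))).1 s hs
    have := hws.1
    refine ⟨by simp; omega, fun w hw => ?_⟩
    rcases List.mem_append.1 hw with hw | hw
    · have := hws.2 w hw; omega
    · obtain rfl := List.mem_singleton.1 hw; omega
  cases op with
  | input o =>
    obtain rfl := (PMF.mem_support_pure_iff _ _).1 hx
    exact fits_nil _
  | checkpoint =>
    obtain ⟨s, hs, rfl⟩ := (PMF.mem_support_map_iff _ _ _).1 hx
    exact sig _ (h.fits_nextCheckpoint hd) s hs
  | restart =>
    obtain ⟨s, hs, rfl⟩ := (PMF.mem_support_map_iff _ _ _).1 hx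
    exact sig _ (h.fits_recoveryMarker (by simpa using Or.inl hd.fieldLen)) s hs
  | foreignQuote =>
    simp only [Protocol.enclaveStep] at hx
    split_ifs at hx
    · obtain rfl := (PMF.mem_support_pure_iff _ _).1 hx
      exact ⟨by simp, by simp⟩
    · obtain ⟨s, hs, rfl⟩ := (PMF.mem_support_map_iff _ _ _).1 hx
      have := (hq _ _ ⟨by simp, by
        have h1 := h.attSk
        have h2 := hd.fieldLen
        have h3 := hd.measurement
        simp only [List.mem_cons, List.not_mem_nil, or_false, forall_eq_or_imp, forall_eq,
          List.length_take]
        omega⟩).2 s hs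
      refine ⟨by simp, ?_⟩
      simp only [List.mem_singleton, forall_eq]
      omega

/-- The invariant of the experiment after at most `t` operations, for a side channel whose memory
has size at most `b`. -/
structure World.Valid (Pi : Protocol) (sk : Word) (d t b : ℕ) (w : World (List Word)) : Prop where
  sk_eq : w.enclave.sk = sk
  small : w.enclave.Small d t
  certified : w.enclave.Certified Pi
  channel : Fits b w.channel

section

variable {Pi : Protocol} {n ℓ : ℕ} {d T q : ℕ} {sk : Word} (S : ℕ → Prog Empty)

/-- Bound on the tuples present after `t` operations. -/
def growth (B c t : ℕ) : ℕ := B + c * t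

/-- The increment `(S n).size + 11` has three sources: one word for the operation code prepended to
the simulator's input, the size of the simulator, and at most ten words of reply in front of the
observation. -/
theorem teeOracle_valid (hd : Pi.FixedSize n d) (hq : Pi.SignaturesBounded n (d + T + 10) q)
    (hsk : sk.length ≤ d) {t : ℕ} (ht : t < T) {op : EnclaveOp} {args : List Word}
    {w : World (List Word)}
    (hargs : Fits (growth (d + T + q + 10) ((S n).size + 11) t) args)
    (hw : w.Valid Pi sk d t (growth (d + T + q + 10) ((S n).size + 11) t))
    {y : List Word × World (List Word)}
    (hy : y ∈ (simOracle Pi n S op args w).support) :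
    Fits (growth (d + T + q + 10) ((S n).size + 11) (t + 1)) y.1 ∧
      y.2.Valid Pi sk d (t + 1) (growth (d + T + q + 10) ((S n).size + 11) (t + 1)) := by
  set B := d + T + q + 10 with hB
  have hg : growth B ((S n).size + 11) (t + 1) =
      growth B ((S n).size + 11) t + 1 + (S n).size + 10 := by
    simp only [growth]; ring
  have hge : B ≤ growth B ((S n).size + 11) t := Nat.le_add_right _ _
  set m := growth B ((S n).size + 11) t with hm
  obtain ⟨x, hx, hy⟩ := (PMF.mem_support_bind_iff _ _ _).1 hy
  obtain ⟨l, hl, rfl⟩ := (PMF.mem_support_map_iff _ _ _).1 hy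
  obtain ⟨R, hR, rfl⟩ := (PMF.mem_support_map_iff (fun R : Regs => (R 1, R 0)) _ _).1 hl
  have hreply : Fits B x.1 := (hw.small.mono ht.le).fits_reply hd hq (by rw [hw.sk_eq]; exact hsk) hx
  have hcode : op.code.length ≤ 5 := by
    cases op with
    | input o => cases o <;> simp [EnclaveOp.code, unary]
    | _ => simp [EnclaveOp.code, unary]
  have hS := (S n).run_fits (m := m + 1) (ins := [w.channel, op.code :: args, x.1]) (by
    simp only [List.mem_cons, List.not_mem_nil, or_false, forall_eq_or_imp, forall_eq]
    exact ⟨hw.channel.mono (Nat.le_succ _), hargs.cons (by omega), hreply.mono (by omega)⟩) hR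
  refine ⟨?_, ?_, ?_, ?_, ?_⟩
  · refine ⟨?_, fun v hv => ?_⟩
    · have h1 := Protocol.length_reply_le hx
      have h2 := (hS 1).1
      simp only [List.length_append]
      omega
    · rcases List.mem_append.1 hv with hv | hv
      · have := hreply.2 v hv; omega
      · have := (hS 1).2 v hv; omega
  · exact (Protocol.enclaveStep_sk hx).trans hw.sk_eq
  · exact hw.small.step hd op args hx
  · exact hw.certified.step hx
  · exact (hS 0).mono (by omega)

theorem World.Valid.mono {Pi : Protocol} {sk : Word} {d t u b b' : ℕ} {w : World (List Word)}
    (h : w.Valid Pi sk d t b) (hu : t ≤ u) (hb : b ≤ b') : w.Valid Pi sk d u b' :=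
  ⟨h.sk_eq, h.small.mono hu, h.certified, h.channel.mono hb⟩

/-- The invariant persists along every adversary. -/
theorem eval_teeOracle_valid (hd : Pi.FixedSize n d)
    (hq : Pi.SignaturesBounded n (d + T + 10) q) (hsk : sk.length ≤ d) (p : Prog EnclaveOp)
    {t : ℕ} {x : Regs × World (List Word)} (ht : t + p.size ≤ T)
    (hR : ∀ r, Fits (growth (d + T + q + 10) ((S n).size + 11) t) (x.1 r))
    (hw : x.2.Valid Pi sk d t (growth (d + T + q + 10) ((S n).size + 11) t))
    {y : Regs × World (List Word)}
    (hy : y ∈ (p.eval (simOracle Pi n S) x).support) :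
    (∀ r, Fits (growth (d + T + q + 10) ((S n).size + 11) (t + p.size)) (y.1 r)) ∧
      y.2.Valid Pi sk d (t + p.size)
        (growth (d + T + q + 10) ((S n).size + 11) (t + p.size)) := by
  have hb : ∀ t, growth (d + T + q + 10) ((S n).size + 11) t + 1 ≤
      growth (d + T + q + 10) ((S n).size + 11) (t + 1) := fun t => by
    simp only [growth, mul_add]; omega
  exact p.eval_invariant (simOracle Pi n S)
    (growth (d + T + q + 10) ((S n).size + 11)) hb T
    (fun t w => World.Valid Pi sk d t (growth (d + T + q + 10) ((S n).size + 11) t) w)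
    (fun t s h => World.Valid.mono h (Nat.le_succ t) ((Nat.le_succ _).trans (hb t)))
    (fun t ht o a s ha hs y hy => teeOracle_valid S hd hq hsk ht ha hs hy) t x ht hR hw y hy

/-- Induction on the adversary's program: encoding the state commutes with every instruction, and
with a query by `eval_opHandler`. The invariant keeps all inputs within the range where the machines
are correct. The equality of laws is exact, and `encodeState` forgets the transcript and the event
origins. -/
theorem eval_simulate (M : Machines Pi n ℓ) (hd : Pi.FixedSize n d)
    (hq : Pi.SignaturesBounded n (d + T + 10) q) (hsk : sk.length ≤ d)
    (hℓ : (d + T + 9) * (d + T + 10) ≤ ℓ) (p : Prog EnclaveOp) :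
    ∀ (t : ℕ) (x : Regs × World (List Word)), t + p.size ≤ T →
      (∀ r, Fits (growth (d + T + q + 10) ((S n).size + 11) t) (x.1 r)) →
      x.2.Valid Pi sk d t (growth (d + T + q + 10) ((S n).size + 11) t) →
      (simulate M (S n) T p).eval (Pi.sig.signOracle n sk) (encodeState x) =
        (p.eval (simOracle Pi n S) x).map encodeState := by
  have upd : ∀ (x : Regs × World (List Word)) (r : ℕ) (v : List Word),
      (Function.update (encodeState x).1 (r + 8) v, (encodeState x).2) =
        encodeState (Function.update x.1 r v, x.2) := fun x r v => by
    simp only [encodeState, update_prependRegs]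
  have get : ∀ (x : Regs × World (List Word)) (r : ℕ), (encodeState x).1 (r + 8) = x.1 r :=
    fun x r =>
    prependRegs_add (stateRegs x.2.enclave x.2.channel) _ _
  induction p with
  | skip => intro t x _ _ _; exact (PMF.pure_map _ _).symm
  | seq p q ihp ihq =>
    intro t x ht hR hw
    simp only [Prog.size] at ht
    simp only [simulate, Prog.eval]
    rw [ihp t x (by omega) hR hw, PMF.bind_map, PMF.map_bind]
    refine pmf_bind_congr fun y hy => ?_
    obtain ⟨h1, h2⟩ := eval_teeOracle_valid S hd hq hsk p (by omega) hR hw hy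
    exact ihq _ y (by omega) h1 h2
  | clear r =>
    intro t x _ _ _
    simp only [simulate, Prog.eval, pmf_pure, PMF.pure_map, upd]
  | newWord r =>
    intro t x _ _ _
    simp only [simulate, Prog.eval, pmf_pure, PMF.pure_map, get, upd]
  | pushBit b r =>
    intro t x _ _ _
    simp only [simulate, Prog.eval, pmf_pure, PMF.pure_map, get, upd]
  | flip r =>
    intro t x _ _ _
    simp only [simulate, Prog.eval, get, upd, PMF.map_comp]
    rfl
  | popBit r =>
    intro t x _ _ _
    simp only [simulate, Prog.eval, pmf_pure, PMF.pure_map, get, upd]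
  | pushWord s r =>
    intro t x _ _ _
    simp only [simulate, Prog.eval, pmf_pure, PMF.pure_map, get, upd]
  | popWord r =>
    intro t x _ _ _
    simp only [simulate, Prog.eval, pmf_pure, PMF.pure_map, get, upd]
  | copy s r =>
    intro t x _ _ _
    simp only [simulate, Prog.eval, pmf_pure, PMF.pure_map, get, upd]
  | branch r p1 p2 p3 p4 ih1 ih2 ih3 ih4 =>
    intro t x ht hR hw
    simp only [Prog.size] at ht
    simp only [simulate, Prog.eval, get]
    split
    · exact ih1 t x (by omega) hR hw
    · exact ih2 t x (by omega) hR hw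
    · exact ih3 t x (by omega) hR hw
    · exact ih4 t x (by omega) hR hw
  | call p ins outs ih =>
    intro t x ht hR hw
    simp only [Prog.size] at ht
    simp only [simulate, Prog.eval]
    have hins : (List.range 8 ++ ins.map (· + 8)).map (encodeState x).1 =
        stateRegs x.2.enclave x.2.channel ++ ins.map x.1 := map_prependRegs rfl _ _
    rw [hins, loadRegs_append rfl]
    have := ih t (loadRegs (ins.map x.1), x.2) (by omega) (fits_loadRegs (by
      intro ws hws
      obtain ⟨i, _, rfl⟩ := List.mem_map.1 hws
      exact hR i)) hw
    refine (congrArg _ this).trans ?_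
    rw [PMF.map_comp, PMF.map_comp]
    congr 1
    funext y
    simp only [Function.comp_apply, encodeState, storeRegs_prependRegs]
  | ask op s r =>
    intro t x ht hR hw
    simp only [Prog.size] at ht
    simp only [simulate]
    have hins : (List.range 8 ++ [s].map (· + 8)).map (encodeState x).1 =
        stateRegs x.2.enclave x.2.channel ++ [x.1 s] := map_prependRegs rfl _ _
    -- The code is generated with the uniform bound `T`, so the size bound at time `t` is weakened
    -- to `T`.
    have h := eval_opHandler M hd S (hw.small.mono (by omega : t ≤ T)) hℓ op (x.1 s)
    rw [hw.sk_eq, ← hins] at h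
    have h : _ = (simOracle Pi n S op (x.1 s) x.2).map fun y =>
        (stateRegs y.2.enclave y.2.channel ++ [y.1], y.2.enclave.signed) := h
    refine (Prog.eval_call_of_map (outs := List.range 8 ++ [r].map (· + 8)) h).trans ?_
    rw [Prog.eval, PMF.map_comp]
    congr 1
    funext y
    simp only [Function.comp_apply, encodeState, Prod.mk.injEq, and_true]
    rw [loadRegs_append rfl, storeRegs_prependRegs, Prog.storeRegs_singleton]
    rfl

end

/-! ### The forger -/

namespace Prog

variable {Op σ : Type} {O : Oracle Op σ} {l : List (List Word)} {s r : ℕ} {st : σ}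

/-- Delete the first `k` words of register `r`. -/
def popWords (r : ℕ) : ℕ → Prog Op
  | 0 => skip
  | k + 1 => seq (popWord r) (popWords r k)

theorem size_popWords (r k : ℕ) : (popWords r k : Prog Op).size = 2 * k + 1 := by
  induction k with
  | zero => rfl
  | succ k ih => simp only [popWords, size, ih]; omega

theorem load_popWords {k : ℕ} (hr : r < l.length) : (popWords r k).eval O (loadRegs l, st) =
    PMF.pure (loadRegs (l.set r ((l.getD r []).drop k)), st) := by
  induction k generalizing l with
  | zero => simp [popWords, eval, pmf_pure, hr]
  | succ k ih =>
    rw [popWords, eval, load_popWord hr, PMF.pure_bind, ih (by simpa using hr)]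
    simp [hr]

theorem load_revOnto_take {k : ℕ} (h : s ≠ r) (hs : s < l.length) (hr : r < l.length) :
    (revOnto s r k).eval O (loadRegs l, st) =
      PMF.pure (loadRegs ((l.set r (((l.getD s []).take k).reverse ++ l.getD r [])).set s
        ((l.getD s []).drop k)), st) := by
  rw [← update_loadRegs (by simpa using hs), ← update_loadRegs hr, eval_revOnto O h]
  rfl

theorem load_flips {k : ℕ} {vs : List Word} (h : l.getD r [] = [] :: vs) (hr : r < l.length) :
    (flips r k).eval O (loadRegs l, st) =
      (uniformWord k).map fun w => (loadRegs (l.set r (w :: vs)), st) := by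
  simp only [← update_loadRegs hr]
  exact eval_flips O r k h st

end Prog

/-- Split register `0` after deleting `k` words: the next nine words stay in register `0`, the rest
goes to register `1`. -/
def extractMessage (k : ℕ) : Prog Unit :=
  .block [.popWords 0 k, .revOnto 0 2 9, .copy 0 1, .clear 0, .revOnto 2 0 9]

open Prog in
theorem eval_call_extractMessage {σ : Type} (O : Oracle Unit σ) (k : ℕ) (R : Regs) (st : σ) :
    (call (extractMessage k) [0] [0, 1]).eval O (R, st) =
      PMF.pure (Function.update (Function.update R 0 (((R 0).drop k).take 9)) 1
        ((R 0).drop (k + 9)), st) := by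
  rw [eval, extractMessage]
  simp only [List.map_cons, List.map_nil]
  rw [← loadRegs_append_nil _ 2]
  simp only [List.cons_append, List.nil_append, List.replicate]
  rw [eval_block_of_pure (load_popWords (by simp))]
  rw [eval_block_of_pure (load_revOnto_take (by simp) (by simp) (by simp))]
  rw [eval_block_of_pure (load_copy (by simp))]
  rw [eval_block_of_pure (load_clear (by simp))]
  rw [eval_block_of_pure (load_revOnto_take (by simp) (by simp) (by simp))]
  rw [eval_block_nil, PMF.pure_map]
  simp [storeRegs_pair, loadRegs, List.take_of_length_le]

theorem loadRegs_apply (l : List (List Word)) (i : ℕ) : loadRegs l i = l.getD i [] := rfl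

section

variable {Pi : Protocol} {n ℓ : ℕ} (M : Machines Pi n ℓ)

/-- Run the adversary against a simulated trusted hardware, and output checkpoint number `i` of its
evidence with the signature. -/
def forger (S : Prog Empty) (A : Prog EnclaveOp) (i : ℕ) : Prog Unit := .block
  [.compute M.attKeyGen 1 2, .newWord 3, .flips 3 n, .copy 2 4, .popWord 4,
    .pushConst Pi.measurement 5, .pushAll [2, 5, 0] 6, .compute M.attSign 6 7,
    .pushAll [3, 0, 4, 7] 8, .compute M.hash 3 9, .pushAll [2] 10, .newWord 11,
    .call (simulate M S A.size A) [10, 9, 11, 3, 12, 11, 8, 11, 8] [1, 2, 3, 4, 5, 6, 7, 8, 0],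
    .call (extractMessage (10 * i + 1)) [0] [0, 1]]

theorem size_forger_le {d : ℕ} (hd : Pi.FixedSize n d) (S : Prog Empty) (A : Prog EnclaveOp)
    (i : ℕ) : (forger M S A i).size ≤
      A.size * (S.size + 6 * M.size + 46 * d + 12 * A.size + 1020) + 20 * i + M.size + 4 * d +
        500 := by
  have h1 := size_simulate_le M (T := A.size) hd S A
  have h2 := hd.nonce
  have h3 := hd.measurement
  generalize A.size * (S.size + 6 * M.size + 46 * d + 12 * A.size + 1020) = K at h1 ⊢
  simp [forger, extractMessage, Prog.size_block, Prog.size, Prog.size_flips, Prog.size_pushConst,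
    Prog.size_pushAll, Prog.size_popWords, Prog.size_revOnto, Prog.compute, Prog.size_embed,
    Machines.size]
  omega

end

/-- Checkpoint number `i` of the evidence, read without parsing it, is validly signed but was not
issued by the enclave. -/
def Protocol.forgesAt (Pi : Protocol) (n i : ℕ) (v : View) : Bool :=
  Pi.sig.verify n v.pk ((v.output.drop (10 * i + 1)).take 9)
      ((v.output.drop (10 * i + 10)).headD []) &&
    decide ((v.output.drop (10 * i + 1)).take 9 ∉ v.issued.map fun x => x.checkpoint.words)

theorem length_of_mem_support_uniformWord {n : ℕ} {w : Word} (h : w ∈ (uniformWord n).support) :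
    w.length = n := by
  by_contra hw
  exact (PMF.mem_support_iff _ _).1 h (by rw [uniformWord_apply, if_neg hw])

/-- The keys have at most `d` bits. -/
structure Protocol.KeysBounded (Pi : Protocol) (n d : ℕ) : Prop where
  sig : ∀ k ∈ (Pi.sig.keyGen n).support, k.1.length ≤ d ∧ k.2.length ≤ d
  att : ∀ k ∈ (Pi.att.keyGen n).support, k.1.length ≤ d ∧ k.2.length ≤ d

section

variable {Pi : Protocol} {n ℓ : ℕ} {d T q : ℕ}

/-- The start of the experiment satisfies the invariant. -/
theorem initEnclave_valid (hd : Pi.FixedSize n d) (hk : Pi.KeysBounded n d)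
    (hq : Pi.SignaturesBounded n (d + T + 10) q) {k a : Word × Word} {nonce quote : Word}
    (hks : k ∈ (Pi.sig.keyGen n).support) (has : a ∈ (Pi.att.keyGen n).support)
    (hns : nonce ∈ (uniformWord n).support)
    (hqs : quote ∈ (Pi.att.sign n a.1 [Pi.measurement, k.2]).support) (c : ℕ) :
    (∀ r, Fits (growth (d + T + q + 10) c 0) (loadRegs [[nonce, k.2, a.2, quote]] r)) ∧
      World.Valid Pi k.1 d 0 (growth (d + T + q + 10) c 0)
        { enclave := Pi.initEnclave n k.1 k.2 a.1 a.2 nonce quote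
          channel := [nonce, k.2, a.2, quote]
          transcript := [] } := by
  have h1 := hk.sig k hks
  have h2 := hk.att a has
  have h3 := length_of_mem_support_uniformWord hns
  have h4 := hd.nonce
  have h5 := hd.measurement
  have h6 := (hq _ _ ⟨by simp, by
    simp only [List.mem_cons, List.not_mem_nil, or_false, forall_eq_or_imp, forall_eq]
    omega⟩).2 quote hqs
  have hpub : Fits (growth (d + T + q + 10) c 0) [nonce, k.2, a.2, quote] := by
    refine ⟨by simp [growth], ?_⟩
    simp only [List.mem_cons, List.not_mem_nil, or_false, forall_eq_or_imp, forall_eq, growth]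
    omega
  refine ⟨fits_loadRegs (by simpa using hpub), rfl, ?_, ?_, hpub⟩
  · exact ⟨h2.1, hd.hash _, by simp [Protocol.initEnclave], h3.trans_le h4,
      by simp [Protocol.initEnclave], by simp [Protocol.initEnclave],
      by simp [Protocol.initEnclave]⟩
  · exact ⟨by simp [Protocol.initEnclave], by simp [Protocol.initEnclave],
      by simp [Protocol.initEnclave], by simp [Protocol.initEnclave]⟩

theorem of_mem_support_trustInvExp (hd : Pi.FixedSize n d) (hk : Pi.KeysBounded n d)
    {A : ℕ → Prog EnclaveOp} (hq : Pi.SignaturesBounded n (d + (A n).size + 10) q)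
    (S : ℕ → Prog Empty) {v : View}
    (hv : v ∈ (Pi.trustInvExp n (simulatedChannel S) A).support) :
    (∃ e : Enclave, e.Certified Pi ∧ e.issued = v.issued) ∧
      v.output.length ≤ growth (d + (A n).size + q + 10) ((S n).size + 11) (A n).size := by
  obtain ⟨k, hks, hv⟩ := (PMF.mem_support_bind_iff _ _ _).1 hv
  obtain ⟨a, has, hv⟩ := (PMF.mem_support_bind_iff _ _ _).1 hv
  obtain ⟨nonce, hns, hv⟩ := (PMF.mem_support_bind_iff _ _ _).1 hv
  obtain ⟨quote, hqs, hv⟩ := (PMF.mem_support_bind_iff _ _ _).1 hv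
  obtain ⟨x, hx, rfl⟩ := (PMF.mem_support_map_iff _ _ _).1 hv
  obtain ⟨hR, hw⟩ := initEnclave_valid hd hk hq hks has hns hqs ((S n).size + 11)
  obtain ⟨h1, h2⟩ := eval_teeOracle_valid S hd hq (hk.sig k hks).1 (A n)
    (x := (loadRegs [[nonce, k.2, a.2, quote]], _)) (by simp) hR hw hx
  refine ⟨⟨_, h2.certified, rfl⟩, ?_⟩
  simpa using (h1 0).1

-- The two experiments are matched draw by draw: enclave keys, attestation keys, nonce, quote, then
-- the run of the adversary. The success conditions agree because the oracle's record consists of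
-- the tuples of the issued checkpoints.
open Prog in
theorem forgeExp_forger (hd : Pi.FixedSize n d) (hk : Pi.KeysBounded n d)
    {A : ℕ → Prog EnclaveOp} (hq : Pi.SignaturesBounded n (d + (A n).size + 10) q)
    (hℓ : (d + (A n).size + 9) * (d + (A n).size + 10) ≤ ℓ) (M : Machines Pi n ℓ)
    (S : ℕ → Prog Empty) {F : ℕ → Prog Unit} {i : ℕ} (hF : F n = forger M (S n) (A n) i) :
    Pi.sig.forgeExp F n =
      (Pi.trustInvExp n (simulatedChannel S) A).map (Pi.forgesAt n i) := by
  have len : ∀ {ws}, Fits (d + (A n).size + 9) ws → tupleLength ws ≤ ℓ := fun h =>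
    h.tupleLength_le.trans hℓ
  simp only [SigScheme.forgeExp, Protocol.trustInvExp, PMF.map_bind]
  refine pmf_bind_congr fun k hks => ?_
  rw [hF, forger, ← loadRegs_append_nil _ 12]
  simp only [List.cons_append, List.nil_append, List.replicate]
  rw [eval_block_cons, load_compute_map M.attKeyGen_computes (ws := []) (by simp [tupleLength])
    (by rfl) (by simp), PMF.map_comp, PMF.bind_map, PMF.map_bind]
  refine pmf_bind_congr fun a has => ?_
  simp only [Function.comp_apply, List.set]
  rw [eval_block_of_pure (load_newWord (by simp))]
  rw [eval_block_cons, load_flips (by rfl) (by simp), PMF.bind_map, PMF.map_bind]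
  refine pmf_bind_congr fun nonce hns => ?_
  simp only [Function.comp_apply, List.set]
  rw [eval_block_of_pure (load_copy (by simp))]
  rw [eval_block_of_pure (load_popWord (by simp))]
  rw [eval_block_of_pure (load_pushConst (by simp))]
  rw [eval_block_of_pure (load_pushAll (by simp) (by simp))]
  simp only [List.set, List.getD_cons_succ, List.getD_cons_zero, List.headD_cons, List.map_cons,
    List.map_nil, List.append_nil, List.tail_cons]
  have h1 := hk.sig k hks
  have h2 := hk.att a has
  have h3 := length_of_mem_support_uniformWord hns
  have h4 := hd.nonce
  have h5 := hd.measurement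
  have hquote : tupleLength [a.1, Pi.measurement, k.2] ≤ ℓ := len ⟨by simp, by
    simp only [List.mem_cons, List.not_mem_nil, or_false, forall_eq_or_imp, forall_eq]
    omega⟩
  have hnonce : tupleLength [nonce] ≤ ℓ := len ⟨by simp, by
    simp only [List.mem_cons, List.not_mem_nil, or_false, forall_eq]
    omega⟩
  rw [eval_block_cons, load_compute_map M.attSign_computes hquote (by rfl) (by simp)]
  simp only [PMF.map_comp, PMF.bind_map, PMF.map_bind]
  refine pmf_bind_congr fun quote hqs => ?_
  simp only [Function.comp_apply, List.set]
  rw [eval_block_of_pure (load_pushAll (by simp) (by simp))]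
  rw [eval_block_of_pure (load_compute M.hash_computes hnonce (by rfl) (by simp))]
  rw [eval_block_of_pure (load_pushAll (by simp) (by simp))]
  rw [eval_block_of_pure (load_newWord (by simp))]
  simp only [List.set, List.getD_cons_succ, List.getD_cons_zero, List.headD_cons, List.map_cons,
    List.map_nil, List.append_nil]
  obtain ⟨hR, hw⟩ := initEnclave_valid hd hk hq hks has hns hqs ((S n).size + 11)
  have hsim := eval_simulate S M hd hq (hk.sig k hks).1 hℓ (A n) 0
    (loadRegs [[nonce, k.2, a.2, quote]], _) (by simp) hR hw
  set w₀ : World (List Word) :=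
    { enclave := Pi.initEnclave n k.1 k.2 a.1 a.2 nonce quote
      channel := [nonce, k.2, a.2, quote]
      transcript := [] } with hw₀
  change _ = PMF.map (Pi.forgesAt n i ∘ fun x : Regs × World (List Word) =>
    { nonce := nonce
      pk := k.2
      attVk := a.2
      quote := quote
      issued := x.2.enclave.issued
      transcript := x.2.transcript
      output := x.1 0 })
    ((A n).eval (simOracle Pi n S) (loadRegs [[nonce, k.2, a.2, quote]], w₀))
  -- The nine input registers of the simulation are the initial enclave state, the public values as
  -- initial memory of the simulator, and the public values again as the adversary's input. One
  -- register holding an empty word serves as content and as both unary zeros.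
  have henc : encodeState (loadRegs [[nonce, k.2, a.2, quote]], w₀) =
      (loadRegs (stateRegs w₀.enclave w₀.channel ++ [[nonce, k.2, a.2, quote]]), []) := by
    rw [loadRegs_append rfl]
    rfl
  rw [henc] at hsim
  rw [eval_block_cons, Prog.eval]
  simp only [List.map_cons, List.map_nil, loadRegs_apply, List.getD_cons_succ, List.getD_cons_zero]
  refine (congrArg (fun μ => PMF.map _ (PMF.bind (PMF.map _ μ) _)) hsim).trans ?_
  rw [PMF.map_comp, PMF.bind_map, PMF.map_bind]
  refine pmf_bind_congr fun y _ => ?_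
  simp only [Function.comp_apply]
  rw [eval_block_cons, eval_call_extractMessage, PMF.pure_bind, eval_block_nil, PMF.pure_map]
  -- On return, callee register `8`, which is the adversary's register `0`, lands in register `0`.
  have h0 : ∀ R : Regs, storeRegs [1, 2, 3, 4, 5, 6, 7, 8, 0] (encodeState y).1 R 0 = y.1 0 :=
    fun _ => rfl
  have hs : (encodeState y).2 = y.2.enclave.issued.map fun x => x.checkpoint.words := rfl
  simp [h0, hs, Protocol.forgesAt]

end

/-! ### A winning view contains a forgery -/

theorem Checkpoint.words_injective : Function.Injective Checkpoint.words := by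
  rintro ⟨⟩ ⟨⟩ h
  simpa [Checkpoint.words] using h

/-- Parsing loses nothing, so checkpoint number `j` sits at a fixed offset of the evidence and the
forger can extract it without parsing. -/
theorem eq_flatMap_of_parseChain {ws : List Word} {ch : List SignedCheckpoint}
    (h : parseChain ws = some ch) :
    ws = ch.flatMap fun X => X.checkpoint.words ++ [X.signature] := by
  fun_induction parseChain ws generalizing ch with
  | case1 =>
    obtain rfl : [] = ch := by simpa using h
    rfl
  | case2 i m h c b k y p t s rest ih =>
    obtain ⟨ch', h1, rfl⟩ := Option.map_eq_some_iff.1 h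
    rw [List.flatMap_cons, ← ih h1]
    rfl
  | case3 => simp at h

theorem drop_flatMap_checkpoints {ch : List SignedCheckpoint} {j : ℕ} (hj : j < ch.length) :
    ∃ rest, (ch.flatMap fun X => X.checkpoint.words ++ [X.signature]).drop (10 * j) =
      ch[j].checkpoint.words ++ ch[j].signature :: rest := by
  induction ch generalizing j with
  | nil => simp at hj
  | cons X ch ih =>
    cases j with
    | zero => simp
    | succ j =>
      obtain ⟨rest, hr⟩ := ih (j := j) (by simpa using hj)
      refine ⟨rest, ?_⟩
      have hlen : (X.checkpoint.words ++ [X.signature]).length = 10 := by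
        simp [Checkpoint.words]
      rw [List.flatMap_cons, show 10 * (j + 1) =
        (X.checkpoint.words ++ [X.signature]).length + 10 * j by omega,
        List.drop_length_add_append]
      exact hr

theorem length_le_flatMap_checkpoints (ch : List SignedCheckpoint) :
    ch.length ≤ (ch.flatMap fun X => X.checkpoint.words ++ [X.signature]).length := by
  induction ch with
  | nil => simp
  | cons X ch ih => simp only [List.flatMap_cons, List.length_append, List.length_cons]; omega

theorem unary_injective : Function.Injective unary := fun a b h => by
  simpa [unary] using congrArg List.length h

namespace Protocol

variable {Pi : Protocol} {n : ℕ}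

theorem of_verifyChain {pk : Word} {ch : List SignedCheckpoint} {i : ℕ} {h y : Word}
    (hv : Pi.verifyChain n pk i h y ch = true) {j : ℕ} (hj : j < ch.length) :
    Pi.sig.verify n pk ch[j].checkpoint.words ch[j].signature = true ∧
      ch[j].checkpoint.index = unary (i + j) ∧
      (ch[j].checkpoint.marker = false → ch[j].checkpoint.count ≠ []) := by
  induction ch generalizing i h y j with
  | nil => simp at hj
  | cons X ch ih =>
    have hX : Pi.sig.verify n pk X.checkpoint.words X.signature = true ∧
        X.checkpoint.index = unary i ∧
        (X.checkpoint.marker = false → X.checkpoint.count ≠ []) ∧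
        ∃ h' y', Pi.verifyChain n pk (i + 1) h' y' ch = true := by
      simp only [verifyChain, Bool.and_eq_true, decide_eq_true_eq] at hv
      obtain ⟨⟨⟨h1, h2⟩, _⟩, h4⟩ := hv
      refine ⟨h1, h2, ?_⟩
      split_ifs at h4 with hm
      · exact ⟨by simp [hm], _, _, h4⟩
      · simp only [Bool.and_eq_true, decide_eq_true_eq] at h4
        exact ⟨fun _ => h4.1.1.1.1, _, _, h4.2⟩
    cases j with
    | zero => exact ⟨hX.1, hX.2.1, hX.2.2.1⟩
    | succ j =>
      obtain ⟨_, _, h'⟩ := hX.2.2.2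
      have := ih h' (j := j) (by simpa using hj)
      rw [show i + (j + 1) = i + 1 + j by omega]
      simpa using this

/-- A valid chain of checkpoints issued by the enclave reflects genuine input. -/
theorem genuine_of_forall_mem {e : Enclave} (he : e.Certified Pi) {pk h y q : Word}
    {rest : List Word} {ch : List SignedCheckpoint} (hch : parseChain rest = some ch)
    (hv : Pi.verifyChain n pk 1 h y ch = true)
    (hmem : ∀ (j : ℕ) (hj : j < ch.length),
      ch[j].checkpoint.words ∈ e.issued.map fun x => x.checkpoint.words) :
    Pi.Genuine e.issued (q :: rest) := by
  -- Membership in the record gives some position `k`; the verifier's check and the enclave's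
  -- counter both determine the index field, which forces `k = j`.
  have key : ∀ (j : ℕ) (hj : j < ch.length), ∃ hj' : j < e.issued.length,
      e.issued[j].checkpoint = ch[j].checkpoint := fun j hj => by
    obtain ⟨x, hx, hxw⟩ := List.mem_map.1 (hmem j hj)
    obtain ⟨k, hk, rfl⟩ := List.getElem_of_mem hx
    have hc := Checkpoint.words_injective hxw
    have h1 := he.index k hk
    rw [hc, (of_verifyChain hv hj).2.1] at h1
    obtain rfl : j = k := by have := unary_injective h1; omega
    exact ⟨hk, hc⟩
  -- A longer chain would have a checkpoint at position `e.issued.length`, where `key` demands an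
  -- issued one.
  have hlen : ch.length ≤ e.issued.length := by
    by_contra hlt
    obtain ⟨h1, _⟩ := key e.issued.length (by omega)
    omega
  refine ⟨ch, hch, List.ext_getElem (by simp [hlen]) fun j h1 h2 => ?_, fun x hx hm => ?_⟩
  · obtain ⟨_, h3⟩ := key j (by simpa using h1)
    simp [h3]
  · obtain ⟨j, hj, rfl⟩ := List.getElem_of_mem hx
    have hj' : j < ch.length := by simp at hj; omega
    obtain ⟨h3, h4⟩ := key j hj'
    have h5 : e.issued[j] ∈ e.issued := List.getElem_mem h3
    simp only [List.getElem_take] at hm ⊢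
    refine ⟨he.count _ h5 hm ?_, he.events _ h5⟩
    rw [h4] at hm ⊢
    exact (of_verifyChain hv hj').2.2 hm

/-- If no position held a forgery, every validly signed checkpoint of the chain would have been
issued, and the evidence would be genuine. Offsets are ten words per checkpoint plus one for the
quote. -/
theorem exists_forgesAt {v : View} (hv : Pi.Wins n v)
    (he : ∃ e : Enclave, e.Certified Pi ∧ e.issued = v.issued) :
    ∃ i < v.output.length, Pi.forgesAt n i v = true := by
  obtain ⟨e, he, hei⟩ := he
  obtain ⟨h1, h2⟩ := hv
  rcases ho : v.output with _ | ⟨q, rest⟩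
  · simp [ho, verify] at h1
  rw [ho] at h1 h2
  rcases hch : parseChain rest with _ | ch
  · simp [verify, hch] at h1
  simp only [verify, hch, Bool.and_eq_true] at h1
  by_contra! hno
  refine h2 (hei ▸ genuine_of_forall_mem he hch h1.2 fun j hj => ?_)
  have hrest := eq_flatMap_of_parseChain hch
  have hlen := length_le_flatMap_checkpoints ch
  rw [← hrest] at hlen
  obtain ⟨rest', hr⟩ := drop_flatMap_checkpoints hj
  rw [← hrest] at hr
  have hw : ch[j].checkpoint.words.length = 9 := rfl
  have hm : ((q :: rest).drop (10 * j + 1)).take 9 = ch[j].checkpoint.words := by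
    rw [List.drop_succ_cons, hr, ← hw, List.take_left']
    rfl
  have hs : ((q :: rest).drop (10 * j + 10)).headD [] = ch[j].signature := by
    rw [show 10 * j + 10 = (10 * j + 9) + 1 by omega, List.drop_succ_cons, ← List.drop_drop, hr,
      ← hw, List.drop_left']
    · rfl
    · rfl
  have := hno j (by simp; omega)
  rw [forgesAt, ho, hm, hs, (of_verifyChain h1.2 hj).1] at this
  rw [hei]
  simpa using this

end Protocol

/-! ### Union bound and choice of the polynomial bounds -/

theorem Negligible.polyBounded_mul {f : ℕ → ℝ} (hf : Negligible f) {N : ℕ → ℕ}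
    (hN : PolyBounded N) : Negligible fun n => N n * f n := by
  obtain ⟨p, hp⟩ := hN
  have h1 := hf.polynomial_mul (p.map (Nat.castRingHom ℝ))
  refine Asymptotics.SuperpolynomialDecay.trans_eventually_abs_le h1
    (Filter.Eventually.of_forall fun n => ?_)
  have h2 : (p.map (Nat.castRingHom ℝ)).eval (n : ℝ) = (p.eval n : ℕ) := by
    rw [Polynomial.eval_natCast_map]; simp
  simp only [h2, abs_mul, Nat.abs_cast, Function.comp_apply]
  exact mul_le_mul_of_nonneg_right (Nat.cast_le.2 (hp n)) (abs_nonneg _)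

/-- Union bound over the position of the forgery. -/
theorem trustInvAdv_le {Pi : Protocol} {n ℓ : ℕ} {d q : ℕ} (hd : Pi.FixedSize n d)
    (hk : Pi.KeysBounded n d) {A : ℕ → Prog EnclaveOp}
    (hq : Pi.SignaturesBounded n (d + (A n).size + 10) q)
    (hℓ : (d + (A n).size + 9) * (d + (A n).size + 10) ≤ ℓ) (M : Machines Pi n ℓ)
    (S : ℕ → Prog Empty) {N : ℕ}
    (hN : N = growth (d + (A n).size + q + 10) ((S n).size + 11) (A n).size) :
    ∃ i < N, ∀ F : ℕ → Prog Unit, F n = forger M (S n) (A n) i →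
      Pi.trustInvAdv n (simulatedChannel S) A ≤ N * (Pi.sig.forgeExp F n true).toReal := by
  set μ := Pi.trustInvExp n (simulatedChannel S) A with hμ
  have hne : (Finset.range N).Nonempty := by
    rw [Finset.nonempty_range_iff, hN, growth]; omega
  -- The most likely position of a forgery is chosen as advice for this `n`; no random guess is
  -- needed.
  obtain ⟨i, hi, hmax⟩ := Finset.exists_max_image (Finset.range N)
    (fun i => (μ.map (Pi.forgesAt n i)) true) hne
  refine ⟨i, Finset.mem_range.1 hi, fun F hF => ?_⟩
  rw [forgeExp_forger hd hk hq hℓ M S hF, ← hμ]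
  have h1 : μ.toOuterMeasure {v | Pi.Wins n v} ≤
      μ.toOuterMeasure (⋃ j ∈ Finset.range N, Pi.forgesAt n j ⁻¹' {true}) := by
    refine μ.toOuterMeasure_mono fun v hv => ?_
    -- The inclusion of events is needed only on the support, where the enclave is certified and the
    -- evidence is short.
    obtain ⟨he, hlen⟩ := of_mem_support_trustInvExp hd hk hq S hv.2
    obtain ⟨j, hj, hf⟩ := Protocol.exists_forgesAt hv.1 he
    simp only [Set.mem_iUnion, Finset.mem_range]
    exact ⟨j, hj.trans_le (hN ▸ hlen), hf⟩
  have h2 : μ.toOuterMeasure {v | Pi.Wins n v} ≤ N * (μ.map (Pi.forgesAt n i)) true := by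
    refine (h1.trans (MeasureTheory.measure_biUnion_finset_le _ _)).trans ?_
    refine (Finset.sum_le_card_nsmul _ _ _ fun j hj => ?_).trans_eq
      (by rw [Finset.card_range, nsmul_eq_mul])
    rw [← PMF.toOuterMeasure_map_apply, PMF.toOuterMeasure_apply_singleton]
    exact hmax j hj
  have h3 := ENNReal.toReal_mono
    (ENNReal.mul_ne_top (ENNReal.natCast_ne_top N) (PMF.apply_ne_top _ _)) h2
  rw [ENNReal.toReal_mul, ENNReal.toReal_natCast] at h3
  exact h3

theorem Protocol.FixedSize.mono {Pi : Protocol} {n d d' : ℕ} (h : Pi.FixedSize n d) (hd : d ≤ d') :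
    Pi.FixedSize n d' :=
  ⟨fun ws => (h.hash ws).trans hd, fun k ws => (h.mac k ws).trans hd,
    fun ws => (h.swfOut ws).trans hd, fun ws => (h.swfProof ws).trans hd,
    fun ws => (h.features ws).trans hd, h.fieldLen.trans hd, h.nonce.trans hd,
    h.measurement.trans hd⟩

theorem SigScheme.Efficient.exists_keys_bound {S : SigScheme} (h : S.Efficient) :
    ∃ b : ℕ → ℕ, PolyBounded b ∧
      ∀ n, ∀ k ∈ (S.keyGen n).support, k.1.length ≤ b n ∧ k.2.length ≤ b n := by
  obtain ⟨b, hb, hb'⟩ := h.1.exists_bound (polyBounded_const 0)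
  refine ⟨b, hb, fun n k hk => ?_⟩
  have := (hb' n [] le_rfl [k.1, k.2] ((PMF.mem_support_map_iff _ _ _).2 ⟨k, hk, rfl⟩)).2
  exact ⟨this _ (by simp), this _ (by simp)⟩

theorem SigScheme.Efficient.exists_sign_bound {S : SigScheme} (h : S.Efficient) {m : ℕ → ℕ}
    (hm : PolyBounded m) : ∃ b : ℕ → ℕ, PolyBounded b ∧
      ∀ n k ws, Fits (m n) (k :: ws) → ∀ s ∈ (S.sign n k ws).support, s.length ≤ b n := by
  obtain ⟨b, hb, hb'⟩ := h.2.1.exists_bound (hm.mul (hm.add (polyBounded_const 1)))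
  refine ⟨b, hb, fun n k ws hws s hs => ?_⟩
  exact (hb' n (k :: ws) hws.tupleLength_le [s]
    ((PMF.mem_support_map_iff _ _ _).2 ⟨s, hs, rfl⟩)).2 s (by simp)

/-- The bounds are chosen without circularity: `d` covers digests and keys, `d` and the size of `A`
bound the signed messages, these bound signatures and the input length of the machines, and
everything together bounds the evidence and the forger. -/
theorem exists_negligible_trustInvAdv_le {Pi : Protocol} (hPi : Pi.Efficient)
    (hsig : Pi.sig.EUFCMA) {A : ℕ → Prog EnclaveOp} (hA : PolySize A) {S : ℕ → Prog Empty}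
    (hS : PolySize S) :
    ∃ ν : ℕ → ℝ, Negligible ν ∧ ∀ n, Pi.trustInvAdv n (simulatedChannel S) A ≤ ν n := by
  obtain ⟨d₀, hd₀, hd⟩ := hPi.exists_fixedSize
  obtain ⟨b₁, hb₁, hk₁⟩ := hPi.sig.exists_keys_bound
  obtain ⟨b₂, hb₂, hk₂⟩ := hPi.att.exists_keys_bound
  obtain ⟨d, hdp, hdd⟩ : ∃ d : ℕ → ℕ, PolyBounded d ∧ ∀ n, d n = d₀ n + b₁ n + b₂ n :=
    ⟨_, (hd₀.add hb₁).add hb₂, fun _ => rfl⟩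
  have hd' : ∀ n, Pi.FixedSize n (d n) := fun n => (hd n).mono (by have := hdd n; omega)
  have hk : ∀ n, Pi.KeysBounded n (d n) := fun n => by
    have := hdd n
    refine ⟨fun k hk => ?_, fun k hk => ?_⟩
    · have := hk₁ n k hk; omega
    · have := hk₂ n k hk; omega
  have hm : PolyBounded fun n => d n + (A n).size + 10 := (hdp.add hA).add (polyBounded_const 10)
  obtain ⟨q₁, hq₁, hq₁'⟩ := hPi.sig.exists_sign_bound hm
  obtain ⟨q₂, hq₂, hq₂'⟩ := hPi.att.exists_sign_bound hm
  have hq : ∀ n, Pi.SignaturesBounded n (d n + (A n).size + 10) (q₁ n + q₂ n) :=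
    fun n k ws hws => ⟨fun s hs => (hq₁' n k ws hws s hs).trans (by omega),
      fun s hs => (hq₂' n k ws hws s hs).trans (by omega)⟩
  obtain ⟨M, hM⟩ := hPi.exists_machines (hm.mul hm)
  have hNp : PolyBounded fun n =>
      growth (d n + (A n).size + (q₁ n + q₂ n) + 10) ((S n).size + 11) (A n).size :=
    (((hdp.add hA).add (hq₁.add hq₂)).add (polyBounded_const 10)).add
      ((hS.add (polyBounded_const 11)).mul hA)
  -- The chosen positions form a sequence of advice, one for each security parameter, and assemble
  -- into a single forger family.
  choose i hi hF using fun n => trustInvAdv_le (hd' n) (hk n) (hq n)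
    (Nat.mul_le_mul (by omega) le_rfl) (M n) S rfl
  have hFp : PolySize fun n => forger (M n) (S n) (A n) (i n) := by
    refine PolyBounded.of_le ?_ fun n => (size_forger_le (M n) (hd' n) (S n) (A n) (i n)).trans
      (Nat.add_le_add_right (Nat.add_le_add_right (Nat.add_le_add_right (Nat.add_le_add_left
        (Nat.mul_le_mul_left 20 (hi n).le) _) _) _) _)
    have c := polyBounded_const
    exact ((((hA.mul ((((hS.add ((c 6).mul hM)).add ((c 46).mul hdp)).add
      ((c 12).mul hA)).add (c 1020))).add ((c 20).mul hNp)).add hM).add ((c 4).mul hdp)).add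
      (c 500)
  exact ⟨_, (hsig _ hFp).polyBounded_mul hNp,
    fun n => hF n _ rfl⟩

end ProcAtt

theorem theorem3 (Pi : ProcAtt.Protocol) (hPi : Pi.Efficient) (hsig : Pi.sig.EUFCMA)
    (L : ProcAtt.SideChannel) (ε : ℕ → ℝ)
    (A : ℕ → ProcAtt.Prog ProcAtt.EnclaveOp) (hA : ProcAtt.PolySize A)
    (hleak : Pi.LeakageBounded L A ε) :
    ∃ ν : ℕ → ℝ, ProcAtt.Negligible ν ∧ ∀ n, Pi.trustInvAdv n L A ≤ ε n + ν n := by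
  obtain ⟨S, hS, hview⟩ := hleak
  obtain ⟨ν, hν, hadv⟩ := ProcAtt.exists_negligible_trustInvAdv_le hPi hsig hA hS
  refine ⟨ν, hν, fun n => ?_⟩
  -- The leakage bound is applied to the set of winning views; one side of the absolute value
  -- suffices.
  have h1 := (abs_le.1 (hview n {v | Pi.Wins n v})).2
  have h2 := hadv n
  simp only [ProcAtt.Protocol.trustInvAdv] at h2 ⊢
  linarith
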